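/- Let $S,A$ be finite non-empty sets of states and actions of a Markov decision process with transition probabilities $p(s'|s,a)$ and random rewards $r(s,a)$ with mean $R(s,a)$ and $|r(s,a)|\le R_{max}<\infty$ almost surely, and let $\gamma\in(0,1)$ be the discount factor. Let $Q^*(s,a)=\max_\pi Q^\pi(s,a)$ be the optimal Q-function, where $Q^\pi(s,a)$ is the expected discounted reward $\mathbb E\big[\sum_{i\ge0}\gamma^i r_i\big]$ when $a$ is taken in $s$ and the policy $\pi:S\to A$ is followed afterwards. Synchronous Q-learning with uniform experience replay, with parameters $K\ge1$, $M\ge0$, starts from arbitrary $Q_0:S\times A\to\mathbb R$ and repeats the following: $K$ online iterations, then $M$ replay iterations. In an online iteration, for every pair $(s,a)$ a reward and a next state $(r,s')$ are sampled from the MDP, independently of the past, and stored in a memory buffer; in a replay iteration, for every pair $(s,a)$ a transition $(r,s')$ is drawn, independently of the past, uniformly at random from all the stored transitions of $(s,a)$. In both cases, iteration $t=1,2,\dots$ updates all pairs simultaneously by $$Q_t(s,a)=\Big(1-\tfrac1{n(s,a)}\Big)Q_{t-1}(s,a)+\tfrac1{n(s,a)}\Big(r+\gamma\max_{a'}Q_{t-1}(s',a')\Big),$$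 where $n(s,a)=t$ is the number of updates of $Q(s,a)$ up to and including iteration $t$. Let $c\in(0,1)$ be a covering constant: after any number $t$ of iterations the buffer holds at least $\frac{c\,t}{|S||A|}$ transitions of every pair. (This holds if any $|S||A|/c$ consecutive iterations contain, for each pair, an online sample of it; and it also holds if $c\le\frac K{M+K}$.) Put $V_{max}=\frac{R_{max}}{1-\gamma}$, $D_0=V_{max}+\max(\|Q_0\|_\infty,V_{max})$ and $N=\frac{2}{1-\gamma}\log\frac{D_0}{\epsilon_1}$ (with $N=0$ if $D_0=0$). Then there is a universal constant $C>0$ such that, in every such setting and for all $\epsilon_1>0$ and $\delta\in(0,1)$, with probability at least $1-\delta$, $$\|Q_t-Q^*\|_\infty\le\epsilon_1\quad\text{for all } t\ge T,$$ where $$T=C\cdot3^{\frac{2}{1-\gamma}\log\frac{D_0}{\epsilon_1}}\cdot\max\left\{1,\ \frac{|S||A|\,R_{max}^2\left(\log\frac{|S||A|}{\delta}+\log\max\{e,N\}\right)}{c\,(1-\gamma)^4\,\epsilon_1^2}\right\}.$$ (The second entry of the outer maximum is the larger one whenever $\epsilon_1\le V_{max}$.) -/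

import Mathlib

open MeasureTheory ProbabilityTheory

noncomputable section

/-- A Markov decision process with state set `S` and action set `A`. Taking action `a` in state `s`
produces a random pair (reward, next state), whose joint law is `outcome s a`. -/
structure MDP (S A : Type*) [MeasurableSpace S] where
  outcome : S → A → Measure (ℝ × S)
  isProb : ∀ s a, IsProbabilityMeasure (outcome s a)

namespace MDP

variable {S A : Type*} [MeasurableSpace S] (mdp : MDP S A)

/-- The transition probability `p(s' | s, a)`. -/
def transProb (s : S) (a : A) (s' : S) : ℝ := (mdp.outcome s a).real {x | x.2 = s'}

/-- The mean reward `R(s, a) = E[r(s, a)]`. -/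
def meanReward (s : S) (a : A) : ℝ := ∫ x, x.1 ∂(mdp.outcome s a)

/-- `E[r_i | s_0 = s, π]`: the expected reward of step `i` when the policy `π` is followed
from the state `s`. -/
def expReward [Fintype S] (π : S → A) : ℕ → S → ℝ
  | 0, s => mdp.meanReward s (π s)
  | i + 1, s => ∑ s', mdp.transProb s (π s) s' * expReward π i s'

/-- The value `V^π(s) = E[∑ γ^i r_i | s_0 = s, π]` of the policy `π`. -/
def value [Fintype S] (γ : ℝ) (π : S → A) (s : S) : ℝ :=
  ∑' i : ℕ, γ ^ i * mdp.expReward π i s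

/-- `Q^π(s, a)`: the expected discounted reward when `a` is taken in `s` and the policy `π` is
followed afterwards. -/
def policyQ [Fintype S] (γ : ℝ) (π : S → A) (s : S) (a : A) : ℝ :=
  mdp.meanReward s a + γ * ∑ s', mdp.transProb s a s' * mdp.value γ π s'

/-- The optimal Q-function `Q^*(s, a) = max_π Q^π(s, a)`. -/
def optimalQ [Fintype S] (γ : ℝ) (s : S) (a : A) : ℝ := ⨆ π : S → A, mdp.policyQ γ π s a

end MDP

namespace Replay

/-- The schedule: `K` online iterations, then `M` replay iterations, then `K` online iterations,
and so on. Iterations are numbered `0, 1, 2, …`; iteration `t` turns `Q_t` into `Q_{t+1}`. -/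
def IsOnline (M K t : ℕ) : Prop := t % (M + K) < K

instance (M K : ℕ) : DecidablePred (IsOnline M K) := fun t =>
  inferInstanceAs (Decidable (t % (M + K) < K))

/-- The online iterations among the first `t` iterations. As every online iteration samples and
stores exactly one transition of every state-action pair, this indexes, for every pair, the
transitions of that pair in the memory buffer after `t` iterations. -/
def buffer (M K t : ℕ) : Finset ℕ := (Finset.range t).filter (IsOnline M K)

/-- The randomness of synchronous Q-learning with uniform experience replay. At an online iteration
`t` the transition of the pair `(s, a)` sampled from the MDP is `exper t ω s a` (reward and next
state); at a replay iteration `t` the memory replayed for `(s, a)` is the one that was stored at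
iteration `idx t ω s a`, which is uniform over the buffer. Different iterations use independent
randomness. (`exper t` at a replay iteration and `idx t` at an online iteration are never used.) -/
structure IsSampling {S A Ω : Type*} [MeasurableSpace S] [MeasurableSpace Ω]
    (mdp : MDP S A) (M K : ℕ) (μ : Measure Ω)
    (exper : ℕ → Ω → S → A → ℝ × S) (idx : ℕ → Ω → S → A → ℕ) : Prop where
  measurable_exper : ∀ t, Measurable (exper t)
  measurable_idx : ∀ t, Measurable (idx t)
  map_exper : ∀ t, IsOnline M K t → ∀ s a, μ.map (fun ω => exper t ω s a) = mdp.outcome s a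
  uniform_idx : ∀ t, ¬ IsOnline M K t → ∀ s a, ∀ i ∈ buffer M K t,
    μ.real {ω | idx t ω s a = i} = 1 / ((buffer M K t).card : ℝ)
  indep : iIndepFun (fun t ω => (exper t ω, idx t ω)) μ

/-- The transition (reward, next state) with which the pair `(s, a)` is updated at iteration `t`. -/
def transition {S A Ω : Type*} (M K : ℕ) (exper : ℕ → Ω → S → A → ℝ × S)
    (idx : ℕ → Ω → S → A → ℕ) (t : ℕ) (ω : Ω) (s : S) (a : A) : ℝ × S :=
  if IsOnline M K t then exper t ω s a else exper (idx t ω s a) ω s a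

/-- The Q-values after `t` iterations of synchronous Q-learning with experience replay, started from
`Q₀`. All pairs are updated once at every iteration, hence the iteration that turns `Q_t` into
`Q_{t+1}` performs the update number `t + 1` of each pair, and its learning rate is
`1 / n(s, a) = 1 / (t + 1)`. -/
def qValues {S A Ω : Type*} (M K : ℕ) (γ : ℝ) (Q₀ : S → A → ℝ)
    (exper : ℕ → Ω → S → A → ℝ × S) (idx : ℕ → Ω → S → A → ℕ) : ℕ → Ω → S → A → ℝ
  | 0, _, s, a => Q₀ s a
  | t + 1, ω, s, a =>
    (1 - 1 / ((t : ℝ) + 1)) * qValues M K γ Q₀ exper idx t ω s a +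
      1 / ((t : ℝ) + 1) * ((transition M K exper idx t ω s a).1 +
        γ * ⨆ a' : A, qValues M K γ Q₀ exper idx t ω (transition M K exper idx t ω s a).2 a')

/-- `c ∈ (0, 1)` is a covering constant, where `n` is the number of state-action pairs: every pair is
visited at least once per `n / c` iterations, in the sense that after any number `t` of iterations
the buffer holds at least `c t / n` transitions of every pair. The two facts below show that this
is implied by the pointwise reading (any `n / c` consecutive iterations visit all pairs), and also
by `c ≤ K / (M + K)`. -/
def IsCoveringConstant (n M K : ℕ) (c : ℝ) : Prop :=
  0 < c ∧ c < 1 ∧ ∀ t : ℕ, c * t / n ≤ ((buffer M K t).card : ℝ)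

theorem card_buffer (M K q r : ℕ) (hr : r ≤ M + K) :
    (buffer M K ((M + K) * q + r)).card = K * q + min r K := by
  have succ : ∀ t, (buffer M K (t + 1)).card =
      (buffer M K t).card + if IsOnline M K t then 1 else 0 := by
    intro t
    unfold buffer
    rw [Finset.range_add_one, Finset.filter_insert]
    split_ifs <;> simp
  induction q generalizing r with
  | zero =>
    induction r with
    | zero => simp [buffer]
    | succ r ih =>
      have h := ih (by omega)
      rw [← add_assoc, succ, h]
      have : IsOnline M K ((M + K) * 0 + r) ↔ r < K := by
        unfold IsOnline
        rw [Nat.mul_add_mod, Nat.mod_eq_of_lt (by omega)]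
      simp only [this]
      split_ifs <;> omega
  | succ q ihq =>
    induction r with
    | zero =>
      have h := ihq (M + K) le_rfl
      rw [Nat.mul_succ, Nat.add_zero, h, Nat.mul_succ]
      omega
    | succ r ih =>
      have h := ih (by omega)
      rw [← add_assoc, succ, h]
      have : IsOnline M K ((M + K) * (q + 1) + r) ↔ r < K := by
        unfold IsOnline
        rw [Nat.mul_add_mod, Nat.mod_eq_of_lt (by omega)]
      simp only [this]
      split_ifs <;> omega

theorem mul_le_card_buffer (M K t : ℕ) : K * t ≤ (M + K) * (buffer M K t).card := by
  rcases Nat.eq_zero_or_pos (M + K) with h | h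
  · have : K = 0 := by omega
    simp [this]
  · have h1 := Nat.div_add_mod t (M + K)
    have h2 := card_buffer M K (t / (M + K)) (t % (M + K)) (Nat.mod_lt _ h).le
    rw [h1] at h2
    rw [h2]
    have h3 := (Nat.mod_lt t h).le
    generalize t / (M + K) = q at *
    generalize t % (M + K) = r at *
    subst h1
    rcases le_total r K with hr | hr
    · rw [min_eq_left hr]; nlinarith
    · rw [min_eq_right hr]; nlinarith

theorem IsCoveringConstant.of_le {n M K : ℕ} {c : ℝ} (hn : 0 < n) (hK : 0 < K) (h0 : 0 < c)
    (h1 : c < 1) (h : c ≤ (K : ℝ) / (M + K)) : IsCoveringConstant n M K c := by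
  refine ⟨h0, h1, fun t => ?_⟩
  have hb : (K : ℝ) * t ≤ (M + K) * (buffer M K t).card := by exact_mod_cast mul_le_card_buffer M K t
  have hp : (0 : ℝ) < M + K := by positivity
  have hn' : (1 : ℝ) ≤ n := by exact_mod_cast hn
  calc c * t / n ≤ c * t := div_le_self (by positivity) hn'
    _ ≤ (K : ℝ) / (M + K) * t := by gcongr
    _ ≤ _ := by rw [div_mul_eq_mul_div, div_le_iff₀ hp]; linarith

theorem IsCoveringConstant.of_window {n M K : ℕ} {c : ℝ} (hn : 0 < n) (hK : 0 < K) (h0 : 0 < c)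
    (h1 : c < 1) (h : ∀ t : ℕ, ∃ u : ℕ, t ≤ u ∧ (u : ℝ) + 1 ≤ t + n / c ∧ IsOnline M K u) :
    IsCoveringConstant n M K c := by
  refine ⟨h0, h1, fun t => ?_⟩
  obtain ⟨u, hu1, hu2, hu3⟩ := h K
  have hu : M + K ≤ u ∨ M = 0 := by
    by_contra! hc
    unfold IsOnline at hu3
    rw [Nat.mod_eq_of_lt hc.1] at hu3
    omega
  have hn' : (1 : ℝ) ≤ n := by exact_mod_cast hn
  have hM : (M : ℝ) + 1 ≤ n / c := by
    rcases hu with hu | hu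
    · have : (M : ℝ) + K ≤ u := by exact_mod_cast hu
      linarith
    · subst hu
      rw [le_div_iff₀ h0]
      push_cast
      linarith
  have hb : (K : ℝ) * t ≤ (M + K) * (buffer M K t).card := by exact_mod_cast mul_le_card_buffer M K t
  have hK' : (1 : ℝ) ≤ K := by exact_mod_cast hK
  have hM0 : (0 : ℝ) ≤ M := by positivity
  have ht : (t : ℝ) ≤ (M + 1) * (buffer M K t).card := by
    have hB : (0 : ℝ) ≤ (buffer M K t).card := by positivity
    have : (K : ℝ) * t ≤ K * ((M + 1) * (buffer M K t).card) := by
      refine hb.trans ?_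
      have : (M : ℝ) + K ≤ K * (M + 1) := by nlinarith
      nlinarith
    exact le_of_mul_le_mul_left this (by linarith)
  have hM' : c * (M + 1) ≤ n := by rw [le_div_iff₀ h0] at hM; linarith
  rw [div_le_iff₀ (by linarith)]
  calc c * t ≤ c * ((M + 1) * (buffer M K t).card) := by gcongr
    _ = c * (M + 1) * (buffer M K t).card := by ring
    _ ≤ n * (buffer M K t).card := by gcongr
    _ = _ := by ring

/-- `D₀ = V_max + max(‖Q₀‖_∞, V_max)`, with `V_max = R_max / (1 - γ)`. -/
def initDist (γ Rmax normQ₀ : ℝ) : ℝ := Rmax / (1 - γ) + max normQ₀ (Rmax / (1 - γ))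

/-- `(2 / (1 - γ)) log (D₀ / ε₁)`. -/
def numStages (γ ε₁ D₀ : ℝ) : ℝ := 2 / (1 - γ) * Real.log (D₀ / ε₁)

/-- The convergence time, up to a constant factor, with `n = |S||A|`. The term
`log max(e, (2 / (1 - γ)) log (D₀ / ε₁))` is logarithmic in `1 / (1 - γ)` and doubly logarithmic in
`D₀ / ε₁`. The maximum with `1` is relevant only if `ε₁ > V_max`. -/
def convTime (n : ℕ) (γ c ε₁ δ Rmax D₀ : ℝ) : ℝ :=
  3 ^ numStages γ ε₁ D₀ *
    max 1 (n * Rmax ^ 2 *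
      (Real.log (n / δ) + Real.log (max (Real.exp 1) (numStages γ ε₁ D₀))) /
        (c * (1 - γ) ^ 4 * ε₁ ^ 2))

end Replay

end

/-!
With learning rates `1 / t` the value `Q_t (s, a)` is the plain average of the first `t` update
targets `r + γ max Q_k (s', ·)`. Comparing each target with `r + γ max Q^* (s', ·)` splits the error
at time `t` into a part bounded by `γ` times the average of the earlier errors and the average of
the temporal-difference errors of the *fixed* function `Q^*` on the transitions used
(`IsQLearningRun.abs_mul_sub_sub_sum_tdError_le`). The latter are bounded
by `2 V_max`, centred on fresh transitions by the Bellman equation (`MDP.optimalQ_eq`), and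
do not involve the iterates. If from a time `T` on their averages are at most `(1 - γ) ε / 8`, then
tripling the time contracts the error bound by `(1 + γ) / 2` until it reaches `ε`, and `⌈N⌉`
triplings suffice: this is the factor `3 ^ N` (`IsQLearningRun.norm_sub_optimalQ_le_max`).

It remains to bound these averages for all `t ≥ T` at once
(`IsSampling.measure_exists_abs_sum_transition_gt_le`). A replayed error is the buffer average plus
a noise term that is centred given the past. The centred terms form a martingale with bounded
increments, which stays below a line at all times by Ville's inequality
(`measure_abs_sum_gt_line_le`); a line costs no union bound over times. The buffer averages are
averages of the online part of the same martingale. After time `T` each of them is controlled by a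
second line. Before time `T` the early averages are too noisy to be bounded one by one without
losing a logarithm; but their sum up to the single time `T` is one weighted sum of the online terms,
whose squared weights add up to at most `3 T |S| |A| / c` (`sum_replayWeight_sq_le`), so a third
application of the inequality controls it.
-/

noncomputable section

namespace Replay

/-! ### Maximal inequalities -/

open Finset in
/-- Ville's inequality for a multiplicative nonnegative supermartingale with increments `m k`. The
supermartingale property is expressed by testing against nonnegative functions of the past. -/
theorem measure_exists_le_prod_le {Ω : Type*} {mΩ : MeasurableSpace Ω} (μ : Measure Ω)
    [IsProbabilityMeasure μ] (F : Filtration ℕ mΩ) (m : ℕ → Ω → ENNReal)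
    (hm : ∀ k, Measurable[F (k + 1)] (m k))
    (h : ∀ k (u : Ω → ENNReal), Measurable[F k] u → ∫⁻ ω, u ω * m k ω ∂μ ≤ ∫⁻ ω, u ω ∂μ)
    (a : ENNReal) : a * μ {ω | ∃ t, a ≤ ∏ k ∈ range t, m k ω} ≤ 1 := by
  classical
  let P : ℕ → Ω → ENNReal := fun t ω => ∏ k ∈ range t, m k ω
  have hP : ∀ t, Measurable[F t] (P t) := fun t =>
    Finset.measurable_prod _ fun k hk =>
      (hm k).mono (F.mono (by have := mem_range.1 hk; omega)) le_rfl
  let dead : ℕ → Set Ω := fun t => {ω | ∃ j ≤ t, a ≤ P j ω}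
  have hdead : ∀ t, MeasurableSet[F t] (dead t) := by
    intro t
    have : dead t = ⋃ j ∈ Set.Iic t, {ω | a ≤ P j ω} := by
      ext ω; simp [dead]
    rw [this]
    refine MeasurableSet.biUnion (Set.to_countable _) fun j hj => ?_
    exact F.mono hj _ (measurableSet_le measurable_const (hP j))
  -- `U` is the product process stopped when it first reaches `a`.
  let U : ℕ → Ω → ENNReal := fun t => Nat.rec (fun _ => 1)
    (fun t u ω => if ω ∈ dead t then u ω else u ω * m t ω) t
  have U0 : ∀ ω, U 0 ω = 1 := fun ω => rfl
  have US : ∀ t ω, U (t + 1) ω = if ω ∈ dead t then U t ω else U t ω * m t ω :=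
    fun t ω => rfl
  have hU : ∀ t, Measurable[F t] (U t) := by
    intro t
    induction t with
    | zero => exact measurable_const
    | succ t ih =>
      have h1 : Measurable[F (t + 1)] (U t) := ih.mono (F.mono (Nat.le_succ t)) le_rfl
      exact Measurable.ite (F.mono (Nat.le_succ t) _ (hdead t)) h1 (h1.mul (hm t))
  have hint : ∀ t, ∫⁻ ω, U t ω ∂μ ≤ 1 := by
    intro t
    induction t with
    | zero => simp [U0]
    | succ t ih =>
      have hd : MeasurableSet (dead t) := F.le t _ (hdead t)
      have hUm : Measurable (U t) := (hU t).mono (F.le t) le_rfl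
      have e1 : ∀ ω, U (t + 1) ω = (dead t).indicator (U t) ω
          + ((dead t)ᶜ.indicator (U t) ω) * m t ω := by
        intro ω
        rw [US]
        by_cases hω : ω ∈ dead t <;> simp [hω]
      have e2 : ∀ ω, U t ω = (dead t).indicator (U t) ω + (dead t)ᶜ.indicator (U t) ω := by
        intro ω
        by_cases hω : ω ∈ dead t <;> simp [hω]
      calc ∫⁻ ω, U (t + 1) ω ∂μ
          = ∫⁻ ω, (dead t).indicator (U t) ω ∂μ
            + ∫⁻ ω, ((dead t)ᶜ.indicator (U t) ω) * m t ω ∂μ := by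
            simp_rw [e1]
            exact lintegral_add_left (hUm.indicator hd) _
        _ ≤ ∫⁻ ω, (dead t).indicator (U t) ω ∂μ + ∫⁻ ω, (dead t)ᶜ.indicator (U t) ω ∂μ := by
            exact add_le_add le_rfl (h t _ ((hU t).indicator (hdead t).compl))
        _ = ∫⁻ ω, U t ω ∂μ := by
            rw [← lintegral_add_left (hUm.indicator hd)]
            simp_rw [← e2]
        _ ≤ 1 := ih
  have hUP : ∀ t ω, ((∀ j < t, P j ω < a) → U t ω = P t ω) ∧ (ω ∈ dead t → a ≤ U t ω) := by
    intro t ω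
    have key : ∀ t, (∀ j < t, P j ω < a) → U t ω = P t ω := by
      intro t
      induction t with
      | zero => intro _; simp [U0, P]
      | succ t ih =>
        intro hj
        have : ω ∉ dead t := by
          rintro ⟨j, hjt, hja⟩
          exact absurd (hj j (by omega)) (not_lt.2 hja)
        rw [US, if_neg this, ih fun j hjt => hj j (by omega)]
        simp only [P, prod_range_succ]
    refine ⟨key t, ?_⟩
    induction t with
    | zero =>
      rintro ⟨j, hj, hja⟩
      obtain rfl : j = 0 := by omega
      simpa [U0, P] using hja
    | succ t ih =>
      intro hd
      by_cases hω : ω ∈ dead t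
      · rw [US, if_pos hω]; exact ih hω
      · have hlt : ∀ j ≤ t, P j ω < a := fun j hj => not_le.1 fun hja => hω ⟨j, hj, hja⟩
        rw [key (t + 1) fun j hj => hlt j (by omega)]
        obtain ⟨j, hj, hja⟩ := hd
        rcases Nat.lt_or_ge t j with hjt | hjt
        · obtain rfl : j = t + 1 := by omega
          exact hja
        · exact absurd hja (not_le.2 (hlt j hjt))
  have hmono : Monotone dead := fun s t hst ω ⟨j, hj, hja⟩ => ⟨j, hj.trans hst, hja⟩
  have hunion : {ω | ∃ t, a ≤ ∏ k ∈ range t, m k ω} = ⋃ t, dead t := by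
    ext ω
    simp only [Set.mem_ofPred_eq, Set.mem_iUnion]
    exact ⟨fun ⟨t, ht⟩ => ⟨t, t, le_rfl, ht⟩, fun ⟨_, j, _, hj⟩ => ⟨j, hj⟩⟩
  rw [hunion, hmono.measure_iUnion, ENNReal.mul_iSup]
  refine iSup_le fun t => ?_
  calc a * μ (dead t) ≤ a * μ {ω | a ≤ U t ω} := by
        gcongr
        exact fun ω hω => (hUP t ω).2 hω
    _ ≤ ∫⁻ ω, U t ω ∂μ := mul_meas_ge_le_lintegral ((hU t).mono (F.le t) le_rfl) a
    _ ≤ 1 := hint t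

/-- `X` is conditionally sub-Gaussian given the sub-σ-algebra `m`, with variance proxy `R ^ 2`:
`E[exp (l X) | m] ≤ exp (l² R² / 2)` for all `l`. The conditional expectation is expressed by
testing against nonnegative `m`-measurable functions, so that no integrability is needed. -/
def CondSubgaussian {Ω : Type*} {mΩ : MeasurableSpace Ω} (μ : Measure Ω) (m : MeasurableSpace Ω)
    (R : ℝ) (X : Ω → ℝ) : Prop :=
  ∀ (l : ℝ) (u : Ω → ENNReal), Measurable[m] u →
    ∫⁻ ω, u ω * ENNReal.ofReal (Real.exp (l * X ω)) ∂μ ≤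
      ENNReal.ofReal (Real.exp (l ^ 2 * R ^ 2 / 2)) * ∫⁻ ω, u ω ∂μ

open Finset in
/-- A weighted sum of conditionally sub-Gaussian increments stays below a line in the sum of the
squared weights at all times, with the probability of a single Chernoff bound. -/
theorem measure_sum_gt_line_le {Ω : Type*} {mΩ : MeasurableSpace Ω} (μ : Measure Ω)
    [IsProbabilityMeasure μ] (F : Filtration ℕ mΩ) (X : ℕ → Ω → ℝ) (R : ℝ)
    (hX : ∀ k, Measurable[F (k + 1)] (X k)) (hs : ∀ k, CondSubgaussian μ (F k) R (X k))
    (c : ℕ → ℝ) {l : ℝ} (hl : 0 < l) (a : ℝ) :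
    μ {ω | ∃ t, a + l * R ^ 2 / 2 * ∑ k ∈ range t, c k ^ 2 < ∑ k ∈ range t, c k * X k ω} ≤
      ENNReal.ofReal (Real.exp (-(l * a))) := by
  let m : ℕ → Ω → ENNReal := fun k ω =>
    ENNReal.ofReal (Real.exp (l * c k * X k ω - (l * c k) ^ 2 * R ^ 2 / 2))
  have hm : ∀ k, Measurable[F (k + 1)] (m k) := fun k => by
    refine ENNReal.measurable_ofReal.comp (Real.measurable_exp.comp ?_)
    exact ((hX k).const_mul (l * c k)).sub_const _
  have hstep : ∀ k (u : Ω → ENNReal), Measurable[F k] u →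
      ∫⁻ ω, u ω * m k ω ∂μ ≤ ∫⁻ ω, u ω ∂μ := by
    intro k u hu
    have e : ∀ ω, u ω * m k ω = ENNReal.ofReal (Real.exp (-((l * c k) ^ 2 * R ^ 2 / 2))) *
        (u ω * ENNReal.ofReal (Real.exp (l * c k * X k ω))) := by
      intro ω
      simp only [m]
      rw [sub_eq_add_neg, Real.exp_add, ENNReal.ofReal_mul (Real.exp_pos _).le]
      ring
    simp_rw [e]
    rw [lintegral_const_mul' _ _ ENNReal.ofReal_ne_top]
    calc _ ≤ ENNReal.ofReal (Real.exp (-((l * c k) ^ 2 * R ^ 2 / 2))) *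
          (ENNReal.ofReal (Real.exp ((l * c k) ^ 2 * R ^ 2 / 2)) * ∫⁻ ω, u ω ∂μ) := by
          gcongr
          exact hs k (l * c k) u hu
      _ = _ := by
          rw [← mul_assoc, ← ENNReal.ofReal_mul (Real.exp_pos _).le, ← Real.exp_add]
          simp
  have hprod : ∀ t ω, ∏ k ∈ range t, m k ω = ENNReal.ofReal (Real.exp
      (l * (∑ k ∈ range t, c k * X k ω - l * R ^ 2 / 2 * ∑ k ∈ range t, c k ^ 2))) := by
    intro t ω
    simp only [m]
    rw [← ENNReal.ofReal_prod_of_nonneg fun _ _ => (Real.exp_pos _).le, ← Real.exp_sum]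
    congr 2
    rw [mul_sum, ← sum_sub_distrib, mul_sum]
    exact sum_congr rfl fun k _ => by ring
  have hv := measure_exists_le_prod_le μ F m hm hstep (ENNReal.ofReal (Real.exp (l * a)))
  have hpos : ENNReal.ofReal (Real.exp (l * a)) ≠ 0 := by
    simpa using Real.exp_pos _
  calc _ ≤ μ {ω | ∃ t, ENNReal.ofReal (Real.exp (l * a)) ≤ ∏ k ∈ range t, m k ω} := by
        refine measure_mono ?_
        rintro ω ⟨t, ht⟩
        refine ⟨t, ?_⟩
        rw [hprod]
        refine ENNReal.ofReal_le_ofReal (Real.exp_le_exp.2 ?_)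
        exact mul_le_mul_of_nonneg_left (by linarith) hl.le
    _ ≤ (ENNReal.ofReal (Real.exp (l * a)))⁻¹ := by
        rw [← one_div]
        exact (ENNReal.le_div_iff_mul_le (Or.inl hpos) (Or.inl ENNReal.ofReal_ne_top)).2
          (by rwa [mul_comm])
    _ = _ := by rw [Real.exp_neg, ENNReal.ofReal_inv_of_pos (Real.exp_pos _)]

open Finset in
theorem measure_abs_sum_gt_line_le {Ω : Type*} {mΩ : MeasurableSpace Ω} (μ : Measure Ω)
    [IsProbabilityMeasure μ] (F : Filtration ℕ mΩ) (X : ℕ → Ω → ℝ) (R : ℝ)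
    (hX : ∀ k, Measurable[F (k + 1)] (X k)) (hs : ∀ k, CondSubgaussian μ (F k) R (X k))
    (c : ℕ → ℝ) {l : ℝ} (hl : 0 < l) (a : ℝ) :
    μ {ω | ∃ t, a + l * R ^ 2 / 2 * ∑ k ∈ range t, c k ^ 2 < |∑ k ∈ range t, c k * X k ω|} ≤
      2 * ENNReal.ofReal (Real.exp (-(l * a))) := by
  have h1 := measure_sum_gt_line_le μ F X R hX hs c hl a
  have h2 := measure_sum_gt_line_le μ F X R hX hs (fun k => -c k) hl a
  rw [two_mul]
  refine le_trans (measure_mono ?_) ((measure_union_le _ _).trans (add_le_add h1 h2))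
  rintro ω ⟨t, ht⟩
  rcases lt_abs.1 ht with h | h
  · exact Or.inl ⟨t, h⟩
  · exact Or.inr ⟨t, by simpa using h⟩

/-- The pointwise form of Hoeffding's lemma: the last term vanishes in the mean for centred `x`. -/
theorem exp_mul_le_of_abs_le {x R : ℝ} (l : ℝ) (hx : |x| ≤ R) :
    Real.exp (l * x) ≤ Real.exp (l ^ 2 * R ^ 2 / 2) + Real.sinh (l * R) / R * x := by
  obtain ⟨h1, h2⟩ := abs_le.1 hx
  rcases (abs_nonneg x |>.trans hx).eq_or_lt with h0 | h0
  · subst h0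
    have : x = 0 := by linarith
    simp [this]
  have hc : Real.cosh (l * R) ≤ Real.exp (l ^ 2 * R ^ 2 / 2) := by
    have := Real.cosh_le_exp_half_sq (l * R)
    rwa [mul_pow] at this
  have ha : 0 ≤ (R + x) / (2 * R) := div_nonneg (by linarith) (by linarith)
  have hb : 0 ≤ (R - x) / (2 * R) := div_nonneg (by linarith) (by linarith)
  have hconv := convexOn_exp.2 (Set.mem_univ (l * R)) (Set.mem_univ (-(l * R))) ha hb
    (by field_simp; ring)
  simp only [smul_eq_mul] at hconv
  have e1 : (R + x) / (2 * R) * (l * R) + (R - x) / (2 * R) * -(l * R) = l * x := by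
    field_simp; ring
  have e2 : (R + x) / (2 * R) * Real.exp (l * R) + (R - x) / (2 * R) * Real.exp (-(l * R)) =
      Real.cosh (l * R) + Real.sinh (l * R) / R * x := by
    rw [Real.cosh_eq, Real.sinh_eq]
    field_simp; ring
  rw [e1, e2] at hconv
  linarith

end Replay

namespace Replay

/-! ### The noise of online and replayed transitions -/

/-- The σ-algebras generated by the variables `ξ i` with `i < t`, as a filtration in `t`. -/
def pastFiltration {Ω Ξ : Type*} {mΩ : MeasurableSpace Ω} [mΞ : MeasurableSpace Ξ]
    (ξ : ℕ → Ω → Ξ) (hξ : ∀ t, Measurable (ξ t)) : Filtration ℕ mΩ where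
  seq t := ⨆ i ∈ Set.Iio t, mΞ.comap (ξ i)
  mono' _ _ hst := biSup_mono fun _ hi => lt_of_lt_of_le hi hst
  le' _ := iSup₂_le fun i _ => (hξ i).comap_le

section Past

variable {Ω Ξ : Type*} {mΩ : MeasurableSpace Ω} [mΞ : MeasurableSpace Ξ]
    {ξ : ℕ → Ω → Ξ} (hξ : ∀ t, Measurable (ξ t))

theorem measurable_pastFiltration {i t : ℕ} (hi : i < t) :
    Measurable[pastFiltration ξ hξ t] (ξ i) := by
  have : mΞ.comap (ξ i) ≤ pastFiltration ξ hξ t :=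
    le_iSup₂_of_le (f := fun i (_ : i ∈ Set.Iio t) => mΞ.comap (ξ i)) i hi le_rfl
  exact (comap_measurable (ξ i)).mono this le_rfl

theorem lintegral_mul_comp_pastFiltration {μ : Measure Ω} (hind : iIndepFun ξ μ) (t : ℕ)
    {u : Ω → ENNReal} (hu : Measurable[pastFiltration ξ hξ t] u) {g : Ξ → ENNReal}
    (hg : Measurable g) :
    ∫⁻ ω, u ω * g (ξ t ω) ∂μ = (∫⁻ ω, u ω ∂μ) * ∫⁻ ω, g (ξ t ω) ∂μ := by
  have h := indep_iSup_of_disjoint (fun i => (hξ i).comap_le) hind.iIndep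
    (S := Set.Iio t) (T := {t}) (by simp)
  rw [iSup_singleton] at h
  exact lintegral_mul_eq_lintegral_mul_lintegral_of_independent_measurableSpace
    ((pastFiltration ξ hξ).le t) (hξ t).comap_le h hu (hg.comp (comap_measurable (ξ t)))

end Past

/-- The centred noise of iteration `k` for the pair `(s, a)`, for a function `h` of transitions
whose mean under the outcome law is `0`: the value of `h` at the transition that is used, minus, at
a replay iteration, the average of `h` over the buffer. A replayed index outside the buffer, which
has probability `0`, contributes nothing to the first term. -/
def noise {S A Ω : Type*} (M K : ℕ) (exper : ℕ → Ω → S → A → ℝ × S) (idx : ℕ → Ω → S → A → ℕ)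
    (h : ℝ × S → ℝ) (s : S) (a : A) (k : ℕ) (ω : Ω) : ℝ :=
  if IsOnline M K k then h (exper k ω s a)
  else (∑ i ∈ buffer M K k, if idx k ω s a = i then h (exper i ω s a) else 0) -
    (∑ i ∈ buffer M K k, h (exper i ω s a)) / ((buffer M K k).card : ℝ)

theorem mem_buffer {M K t i : ℕ} : i ∈ buffer M K t ↔ i < t ∧ IsOnline M K i := by
  simp [buffer]

theorem card_buffer_pos {M K t : ℕ} (hK : 0 < K) (ht : 0 < t) : 0 < (buffer M K t).card :=
  Finset.card_pos.2 ⟨0, mem_buffer.2 ⟨ht, by simpa [IsOnline] using hK⟩⟩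

theorem pos_of_not_isOnline {M K t : ℕ} (hK : 0 < K) (ht : ¬ IsOnline M K t) : 0 < t := by
  rcases Nat.eq_zero_or_pos t with rfl | h
  · exact absurd (by simpa [IsOnline] using hK) ht
  · exact h

namespace IsSampling

variable {S A Ω : Type*} [MeasurableSpace S] [mΩ : MeasurableSpace Ω] {mdp : MDP S A} {M K : ℕ}
  {μ : Measure Ω} {exper : ℕ → Ω → S → A → ℝ × S} {idx : ℕ → Ω → S → A → ℕ}

theorem measurable_pair (hS : IsSampling mdp M K μ exper idx) (t : ℕ) :
    Measurable fun ω => (exper t ω, idx t ω) :=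
  (hS.measurable_exper t).prodMk (hS.measurable_idx t)

/-- The history before iteration `t`: all experiences and replayed indices of earlier iterations. -/
def history (hS : IsSampling mdp M K μ exper idx) : Filtration ℕ mΩ :=
  pastFiltration (fun t ω => (exper t ω, idx t ω)) hS.measurable_pair

theorem measurable_exper_history (hS : IsSampling mdp M K μ exper idx) {i t : ℕ} (hi : i < t)
    (s : S) (a : A) : Measurable[hS.history t] fun ω => exper i ω s a :=
  (measurable_pi_apply a).comp ((measurable_pi_apply s).comp
    (measurable_fst.comp (measurable_pastFiltration hS.measurable_pair hi)))

theorem measurable_idx_history (hS : IsSampling mdp M K μ exper idx) {i t : ℕ} (hi : i < t)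
    (s : S) (a : A) : Measurable[hS.history t] fun ω => idx i ω s a :=
  (measurable_pi_apply a).comp ((measurable_pi_apply s).comp
    (measurable_snd.comp (measurable_pastFiltration hS.measurable_pair hi)))

theorem measurable_noise (hS : IsSampling mdp M K μ exper idx) {h : ℝ × S → ℝ}
    (hh : Measurable h) (s : S) (a : A) (k : ℕ) :
    Measurable[hS.history (k + 1)] (noise M K exper idx h s a k) := by
  have h1 : ∀ i ∈ buffer M K k, Measurable[hS.history (k + 1)] fun ω => h (exper i ω s a) :=
    fun i hi => hh.comp (hS.measurable_exper_history (by have := (mem_buffer.1 hi).1; omega) s a)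
  unfold noise
  by_cases hk : IsOnline M K k
  · simp only [hk, if_true]
    exact hh.comp (hS.measurable_exper_history (Nat.lt_succ_self k) s a)
  · simp only [hk, if_false]
    refine Measurable.sub (Finset.measurable_sum _ fun i hi => Measurable.ite ?_ (h1 i hi)
      measurable_const) ((Finset.measurable_sum _ h1).div_const _)
    exact hS.measurable_idx_history (Nat.lt_succ_self k) s a (measurableSet_singleton i)

theorem measurableSet_idx_eq (hS : IsSampling mdp M K μ exper idx) (k : ℕ) (s : S) (a : A)
    (i : ℕ) : MeasurableSet {ω | idx k ω s a = i} :=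
  ((measurable_pi_apply a).comp ((measurable_pi_apply s).comp (hS.measurable_idx k)))
    (measurableSet_singleton i)

theorem ae_idx_mem_buffer [IsProbabilityMeasure μ] (hS : IsSampling mdp M K μ exper idx)
    (hK : 0 < K) {k : ℕ} (hk : ¬ IsOnline M K k) (s : S) (a : A) :
    ∀ᵐ ω ∂μ, idx k ω s a ∈ buffer M K k := by
  have hB := card_buffer_pos (M := M) hK (pos_of_not_isOnline hK hk)
  have e : {ω | idx k ω s a ∈ buffer M K k} =
      ⋃ i ∈ buffer M K k, {ω | idx k ω s a = i} := by
    ext ω; simp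
  have h1 : μ.real {ω | idx k ω s a ∈ buffer M K k} = 1 := by
    rw [e, measureReal_biUnion_finset]
    · rw [Finset.sum_congr rfl fun i hi => hS.uniform_idx k hk s a i hi, Finset.sum_const,
        nsmul_eq_mul]
      field_simp
    · intro i _ j _ hij
      refine Set.disjoint_left.2 fun ω h1 h2 => hij ?_
      exact Eq.trans (Eq.symm h1) h2
    · exact fun i _ => hS.measurableSet_idx_eq k s a i
  have hm : MeasurableSet {ω | idx k ω s a ∈ buffer M K k} := by
    rw [e]
    exact Finset.measurableSet_biUnion _ fun i _ => hS.measurableSet_idx_eq k s a i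
  rw [ae_iff]
  have h2 := probReal_compl_eq_one_sub (μ := μ) hm
  rw [h1, sub_self, measureReal_eq_zero_iff] at h2
  exact h2

theorem ae_exper [IsProbabilityMeasure μ] (hS : IsSampling mdp M K μ exper idx) {k : ℕ}
    (hk : IsOnline M K k) (s : S) (a : A) {p : ℝ × S → Prop}
    (hp : ∀ᵐ x ∂(mdp.outcome s a), p x) : ∀ᵐ ω ∂μ, p (exper k ω s a) := by
  rw [← hS.map_exper k hk s a] at hp
  exact ae_of_ae_map ((measurable_pi_apply a).comp ((measurable_pi_apply s).comp
    (hS.measurable_exper k))).aemeasurable hp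

theorem condSubgaussian_noise_online [IsProbabilityMeasure μ]
    (hS : IsSampling mdp M K μ exper idx) {h : ℝ × S → ℝ} (hh : Measurable h) {R : ℝ}
    (hb : ∀ x, |h x| ≤ R) {s : S} {a : A} (h0 : ∫ x, h x ∂(mdp.outcome s a) = 0) {k : ℕ}
    (hk : IsOnline M K k) :
    CondSubgaussian μ (hS.history k) R (noise M K exper idx h s a k) := by
  intro l u hu
  have hme : Measurable fun ω => exper k ω s a := (measurable_pi_apply a).comp
    ((measurable_pi_apply s).comp (hS.measurable_exper k))
  have hg : Measurable fun x : (S → A → ℝ × S) × (S → A → ℕ) =>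
      ENNReal.ofReal (Real.exp (l * h (x.1 s a))) := by
    refine ENNReal.measurable_ofReal.comp (Real.measurable_exp.comp (Measurable.const_mul ?_ l))
    exact hh.comp ((measurable_pi_apply a).comp ((measurable_pi_apply s).comp measurable_fst))
  have hfac := lintegral_mul_comp_pastFiltration hS.measurable_pair hS.indep k hu hg
  simp only [noise, hk, if_true]
  rw [hfac, mul_comm]
  gcongr
  have := mdp.isProb s a
  have hint : Integrable h (mdp.outcome s a) :=
    Integrable.of_bound hh.aestronglyMeasurable R (Filter.Eventually.of_forall hb)
  have hle : ∀ x, Real.exp (l * h x) ≤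
      Real.exp (l ^ 2 * R ^ 2 / 2) + Real.sinh (l * R) / R * h x :=
    fun x => exp_mul_le_of_abs_le l (hb x)
  have hint2 : Integrable (fun x => Real.exp (l ^ 2 * R ^ 2 / 2) + Real.sinh (l * R) / R * h x)
      (mdp.outcome s a) := (integrable_const _).add (hint.const_mul _)
  have hm2 : Measurable fun x => ENNReal.ofReal (Real.exp (l * h x)) :=
    ENNReal.measurable_ofReal.comp (Real.measurable_exp.comp (hh.const_mul l))
  calc ∫⁻ ω, ENNReal.ofReal (Real.exp (l * h (exper k ω s a))) ∂μ
      = ∫⁻ x, ENNReal.ofReal (Real.exp (l * h x)) ∂(mdp.outcome s a) := by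
        rw [← hS.map_exper k hk s a, lintegral_map hm2 hme]
    _ ≤ ∫⁻ x, ENNReal.ofReal (Real.exp (l ^ 2 * R ^ 2 / 2) + Real.sinh (l * R) / R * h x)
          ∂(mdp.outcome s a) :=
        lintegral_mono fun x => ENNReal.ofReal_le_ofReal (hle x)
    _ = ENNReal.ofReal (∫ x, (Real.exp (l ^ 2 * R ^ 2 / 2) + Real.sinh (l * R) / R * h x)
          ∂(mdp.outcome s a)) := by
        rw [ofReal_integral_eq_lintegral_ofReal hint2
          (Filter.Eventually.of_forall fun x => (Real.exp_pos _).le.trans (hle x))]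
    _ = _ := by
        rw [integral_add (integrable_const _) (hint.const_mul _), integral_const_mul, h0]
        simp

/-- Given the past, the replayed index is uniform over the buffer, whose contents are determined by
the past; so Hoeffding's bound holds for the empirical average, whatever the contents. -/
theorem condSubgaussian_noise_replay [IsProbabilityMeasure μ]
    (hS : IsSampling mdp M K μ exper idx) {h : ℝ × S → ℝ} (hh : Measurable h) {R : ℝ}
    (hb : ∀ x, |h x| ≤ R) (s : S) (a : A) (hK : 0 < K) {k : ℕ} (hk : ¬ IsOnline M K k) :
    CondSubgaussian μ (hS.history k) (2 * R) (noise M K exper idx h s a k) := by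
  intro l u hu
  have hB := card_buffer_pos (M := M) hK (pos_of_not_isOnline hK hk)
  set B := buffer M K k with hBdef
  have hB' : (0 : ℝ) < B.card := by exact_mod_cast hB
  let avg : Ω → ℝ := fun ω => (∑ i ∈ B, h (exper i ω s a)) / (B.card : ℝ)
  let v : ℕ → Ω → ENNReal := fun i ω =>
    ENNReal.ofReal (Real.exp (l * (h (exper i ω s a) - avg ω)))
  have hmh : ∀ i ∈ B, Measurable[hS.history k] fun ω => h (exper i ω s a) :=
    fun i hi => hh.comp (hS.measurable_exper_history (mem_buffer.1 hi).1 s a)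
  have hmavg : Measurable[hS.history k] avg := (Finset.measurable_sum _ hmh).div_const _
  have hmv : ∀ i ∈ B, Measurable[hS.history k] (v i) := fun i hi =>
    ENNReal.measurable_ofReal.comp (Real.measurable_exp.comp
      (((hmh i hi).sub hmavg).const_mul l))
  let g : ℕ → (S → A → ℝ × S) × (S → A → ℕ) → ENNReal := fun i x => if x.2 s a = i then 1 else 0
  have hme : Measurable fun x : (S → A → ℝ × S) × (S → A → ℕ) => x.2 s a :=
    (measurable_pi_apply a).comp ((measurable_pi_apply s).comp measurable_snd)
  have hg : ∀ i, Measurable (g i) := fun i =>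
    Measurable.ite (hme (measurableSet_singleton i)) measurable_const measurable_const
  have hgi : ∀ i ∈ B, ∫⁻ ω, g i (exper k ω, idx k ω) ∂μ =
      ENNReal.ofReal (1 / (B.card : ℝ)) := by
    intro i hi
    rw [← hS.uniform_idx k hk s a i hi, ofReal_measureReal,
      ← lintegral_indicator_one (hS.measurableSet_idx_eq k s a i)]
    refine lintegral_congr fun ω => ?_
    simp [g, Set.indicator]
  have hae : ∀ᵐ ω ∂μ, u ω * ENNReal.ofReal (Real.exp (l * noise M K exper idx h s a k ω)) =
      ∑ i ∈ B, (u ω * v i ω) * g i (exper k ω, idx k ω) := by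
    filter_upwards [hS.ae_idx_mem_buffer hK hk s a] with ω hω
    rw [← hBdef] at hω
    rw [Finset.sum_eq_single_of_mem _ hω (fun j _ hj => by simp [g, Ne.symm hj])]
    simp only [noise, hk, if_false, g, if_true, mul_one, v, avg, ← hBdef]
    congr 4
    rw [Finset.sum_ite_eq]
    simp [hω]
  have hmu : Measurable u := hu.mono (hS.history.le k) le_rfl
  have hmv' : ∀ i ∈ B, Measurable (v i) := fun i hi => (hmv i hi).mono (hS.history.le k) le_rfl
  have hpair : Measurable fun ω => (exper k ω, idx k ω) := hS.measurable_pair k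
  have hpt : ∀ ω, ∑ i ∈ B, v i ω * ENNReal.ofReal (1 / (B.card : ℝ)) ≤
      ENNReal.ofReal (Real.exp (l ^ 2 * (2 * R) ^ 2 / 2)) := by
    intro ω
    have habs : ∀ i ∈ B, |h (exper i ω s a) - avg ω| ≤ 2 * R := by
      intro i _
      have h1 : |avg ω| ≤ R := by
        simp only [avg]
        rw [abs_div, Nat.abs_cast, div_le_iff₀ hB']
        refine (Finset.abs_sum_le_sum_abs _ _).trans ?_
        refine (Finset.sum_le_card_nsmul _ _ R fun j _ => hb _).trans ?_
        rw [nsmul_eq_mul, mul_comm]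
      have := abs_sub (h (exper i ω s a)) (avg ω)
      linarith [hb (exper i ω s a)]
    have hsum : ∑ i ∈ B, (h (exper i ω s a) - avg ω) = 0 := by
      rw [Finset.sum_sub_distrib, Finset.sum_const, nsmul_eq_mul]
      simp only [avg]
      field_simp
      simp
    simp only [v]
    rw [← Finset.sum_mul, ← ENNReal.ofReal_sum_of_nonneg fun _ _ => (Real.exp_pos _).le,
      ← ENNReal.ofReal_mul (Finset.sum_nonneg fun _ _ => (Real.exp_pos _).le)]
    refine ENNReal.ofReal_le_ofReal ?_
    rw [mul_one_div, div_le_iff₀ hB']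
    calc _ ≤ ∑ i ∈ B, (Real.exp (l ^ 2 * (2 * R) ^ 2 / 2) +
          Real.sinh (l * (2 * R)) / (2 * R) * (h (exper i ω s a) - avg ω)) :=
          Finset.sum_le_sum fun i hi => exp_mul_le_of_abs_le l (habs i hi)
      _ = _ := by
          rw [Finset.sum_add_distrib, ← Finset.mul_sum, hsum, Finset.sum_const, nsmul_eq_mul]
          ring
  calc ∫⁻ ω, u ω * ENNReal.ofReal (Real.exp (l * noise M K exper idx h s a k ω)) ∂μ
      = ∫⁻ ω, ∑ i ∈ B, (u ω * v i ω) * g i (exper k ω, idx k ω) ∂μ := lintegral_congr_ae hae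
    _ = ∑ i ∈ B, ∫⁻ ω, (u ω * v i ω) * g i (exper k ω, idx k ω) ∂μ :=
        lintegral_finsetSum _ fun i hi =>
          (hmu.mul (hmv' i hi)).mul ((hg i).comp hpair)
    _ = ∑ i ∈ B, ∫⁻ ω, u ω * (v i ω * ENNReal.ofReal (1 / (B.card : ℝ))) ∂μ := by
        refine Finset.sum_congr rfl fun i hi => ?_
        refine (lintegral_mul_comp_pastFiltration hS.measurable_pair hS.indep k
          (hu.mul (hmv i hi)) (hg i)).trans ?_
        rw [hgi i hi, ← lintegral_mul_const _ (hmu.mul (hmv' i hi))]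
        exact lintegral_congr fun ω => mul_assoc _ _ _
    _ = ∫⁻ ω, ∑ i ∈ B, u ω * (v i ω * ENNReal.ofReal (1 / (B.card : ℝ))) ∂μ :=
        (lintegral_finsetSum _ fun i hi => hmu.mul ((hmv' i hi).mul_const _)).symm
    _ ≤ ∫⁻ ω, ENNReal.ofReal (Real.exp (l ^ 2 * (2 * R) ^ 2 / 2)) * u ω ∂μ := by
        refine lintegral_mono fun ω => ?_
        rw [← Finset.mul_sum, mul_comm]
        gcongr
        exact hpt ω
    _ = _ := lintegral_const_mul _ hmu

theorem condSubgaussian_noise [IsProbabilityMeasure μ]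
    (hS : IsSampling mdp M K μ exper idx) {h : ℝ × S → ℝ} (hh : Measurable h) {R : ℝ}
    (hb : ∀ x, |h x| ≤ R) {s : S} {a : A} (h0 : ∫ x, h x ∂(mdp.outcome s a) = 0) (hK : 0 < K)
    (k : ℕ) : CondSubgaussian μ (hS.history k) (2 * R) (noise M K exper idx h s a k) := by
  by_cases hk : IsOnline M K k
  · have hR : (∀ x, |h x| ≤ 2 * R) := fun x => by
      linarith [hb x, abs_nonneg (h x)]
    exact hS.condSubgaussian_noise_online hh hR h0 hk
  · exact hS.condSubgaussian_noise_replay hh hb s a hK hk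

end IsSampling

end Replay

namespace Replay

open Finset

/-! ### Averages over the buffer -/

/-- The average of `x` over the buffer at a replay iteration `k`, and `0` at an online iteration. -/
def bufferMean (M K : ℕ) (x : ℕ → ℝ) (k : ℕ) : ℝ :=
  if IsOnline M K k then 0 else (∑ i ∈ buffer M K k, x i) / ((buffer M K k).card : ℝ)

/-- The weight of the memory stored at iteration `i` in the buffer average of iteration `k`. -/
def bufferWeight (M K k i : ℕ) : ℝ :=
  if IsOnline M K k then 0 else if i ∈ buffer M K k then 1 / ((buffer M K k).card : ℝ) else 0

/-- The total weight of the memory stored at iteration `i` in the buffer averages of all iterations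
before `t`. -/
def replayWeight (M K t i : ℕ) : ℝ := ∑ k ∈ range t, bufferWeight M K k i

variable {M K : ℕ}

theorem buffer_subset_range {k t : ℕ} (h : k ≤ t) : buffer M K k ⊆ range t := fun _ hi =>
  mem_range.2 ((mem_buffer.1 hi).1.trans_le h)

theorem sum_bufferWeight_mul (x : ℕ → ℝ) {k t : ℕ} (h : k ≤ t) :
    ∑ i ∈ range t, bufferWeight M K k i * x i = bufferMean M K x k := by
  unfold bufferWeight bufferMean
  by_cases hk : IsOnline M K k
  · simp [hk]
  · simp only [hk, if_false, ite_mul, zero_mul]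
    rw [← sum_filter, filter_mem_eq_inter, inter_eq_right.2 (buffer_subset_range h), sum_div]
    exact sum_congr rfl fun i _ => by ring

theorem sum_bufferMean (x : ℕ → ℝ) (t : ℕ) :
    ∑ k ∈ range t, bufferMean M K x k = ∑ i ∈ range t, replayWeight M K t i * x i := by
  simp only [replayWeight, sum_mul]
  rw [sum_comm]
  exact sum_congr rfl fun k hk => (sum_bufferWeight_mul x (mem_range.1 hk).le).symm

theorem bufferWeight_nonneg (k i : ℕ) : 0 ≤ bufferWeight M K k i := by
  unfold bufferWeight
  split_ifs <;> positivity

theorem bufferWeight_le (k i : ℕ) : bufferWeight M K k i ≤ 1 / ((buffer M K k).card : ℝ) := by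
  unfold bufferWeight
  split_ifs <;> first | exact le_rfl | positivity

theorem sum_bufferWeight_le {k t : ℕ} (h : k ≤ t) :
    ∑ i ∈ range t, bufferWeight M K k i ≤ 1 := by
  have := sum_bufferWeight_mul (M := M) (K := K) (fun _ => 1) h
  simp only [mul_one] at this
  rw [this]
  unfold bufferMean
  split_ifs
  · exact zero_le_one
  · simp only [sum_const, nsmul_eq_mul, mul_one]
    exact div_self_le_one _

/-- The squared weights are small in total, although the weight of the first memories grows
logarithmically in `t`. -/
theorem sum_replayWeight_sq_le {r : ℝ} (hr : 0 < r)
    (hcov : ∀ t : ℕ, r * t ≤ ((buffer M K t).card : ℝ)) (hK : 0 < K) (t : ℕ) :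
    ∑ i ∈ range t, replayWeight M K t i ^ 2 ≤ 3 * t / r := by
  induction t with
  | zero => simp
  | succ t ih =>
    have hlast : replayWeight M K (t + 1) t = 0 := by
      refine sum_eq_zero fun k hk => ?_
      have hkt : t ∉ buffer M K k := fun h => by
        have h1 := (mem_buffer.1 h).1
        have h2 := mem_range.1 hk
        omega
      simp [bufferWeight, hkt]
    rw [sum_range_succ, hlast]
    have hrec : ∀ i, replayWeight M K (t + 1) i =
        replayWeight M K t i + bufferWeight M K t i := fun i => sum_range_succ _ _
    simp only [hrec]
    push_cast
    by_cases ht : IsOnline M K t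
    · have hz : ∀ i, bufferWeight M K t i = 0 := fun i => by simp [bufferWeight, ht]
      simp only [hz, add_zero]
      have : 3 * (t : ℝ) / r ≤ 3 * (t + 1) / r := by gcongr; linarith
      simpa using ih.trans this
    · have htpos := pos_of_not_isOnline hK ht
      have hB : (0 : ℝ) < (buffer M K t).card := by
        exact_mod_cast card_buffer_pos (M := M) hK htpos
      have ht1 : (1 : ℝ) ≤ t := by exact_mod_cast htpos
      have hw0 : ∀ i, 0 ≤ replayWeight M K t i := fun i =>
        sum_nonneg fun k _ => bufferWeight_nonneg k i
      have hwsum : ∑ i ∈ range t, replayWeight M K t i ≤ t := by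
        simp only [replayWeight]
        rw [sum_comm]
        refine (sum_le_card_nsmul _ _ 1 fun k hk =>
          sum_bufferWeight_le (mem_range.1 hk).le).trans ?_
        simp
      have hcross : ∑ i ∈ range t, replayWeight M K t i * bufferWeight M K t i ≤
          1 / ((buffer M K t).card : ℝ) * t := by
        calc _ ≤ ∑ i ∈ range t, 1 / ((buffer M K t).card : ℝ) * replayWeight M K t i :=
              sum_le_sum fun i _ => by
                rw [mul_comm]
                exact mul_le_mul_of_nonneg_right (bufferWeight_le t i) (hw0 i)
          _ ≤ _ := by
              rw [← mul_sum]
              gcongr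
      have hsq : ∑ i ∈ range t, bufferWeight M K t i ^ 2 ≤ 1 / ((buffer M K t).card : ℝ) := by
        calc _ ≤ ∑ i ∈ range t, 1 / ((buffer M K t).card : ℝ) * bufferWeight M K t i :=
              sum_le_sum fun i _ => by
                rw [sq]
                exact mul_le_mul_of_nonneg_right (bufferWeight_le t i) (bufferWeight_nonneg t i)
          _ ≤ 1 / ((buffer M K t).card : ℝ) * 1 := by
              rw [← mul_sum]
              gcongr
              exact sum_bufferWeight_le le_rfl
          _ = _ := mul_one _
      have hexp : ∑ i ∈ range t, (replayWeight M K t i + bufferWeight M K t i) ^ 2 =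
          ∑ i ∈ range t, replayWeight M K t i ^ 2 +
            2 * ∑ i ∈ range t, replayWeight M K t i * bufferWeight M K t i +
            ∑ i ∈ range t, bufferWeight M K t i ^ 2 := by
        rw [mul_sum, ← sum_add_distrib, ← sum_add_distrib]
        exact sum_congr rfl fun i _ => by ring
      have hinc : 1 / ((buffer M K t).card : ℝ) * (2 * t + 1) ≤ 3 / r := by
        rw [one_div_mul_eq_div, div_le_div_iff₀ hB hr]
        nlinarith [hcov t]
      have h3 : 3 * ((t : ℝ) + 1) / r = 3 * t / r + 3 / r := by ring
      rw [hexp, h3]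
      linarith

/-- If the partial sums of `x`, those over the online iterations, and one weighted sum are small,
then so are the partial sums of `x + bufferMean x` from `T` on. The buffer averages of the
iterations before `T` are not small one by one; their sum is the weighted sum `hweighted`. -/
theorem abs_sum_add_bufferMean_le {x : ℕ → ℝ} {r η : ℝ} {T : ℕ} (hr : 0 < r) (hη : 0 < η)
    (hcov : ∀ t : ℕ, r * t ≤ ((buffer M K t).card : ℝ)) (hK : 0 < K)
    (hsum : ∀ t : ℕ, |∑ k ∈ range t, x k| ≤ η * T + η * t)
    (honline : ∀ t : ℕ, |∑ k ∈ range t, (if IsOnline M K k then 1 else 0) * x k| ≤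
      η * (r * T) + η * (buffer M K t).card)
    (hweighted : |∑ i ∈ range T, replayWeight M K T i * x i| ≤ 2 * η * T) {t : ℕ} (ht : T ≤ t) :
    |∑ k ∈ range t, (x k + bufferMean M K x k)| ≤ 4 * η * t := by
  have hmean : ∀ k, T ≤ k → |bufferMean M K x k| ≤ 2 * η := by
    intro k hk
    unfold bufferMean
    split_ifs with hon
    · simpa using hη.le
    · have hB : (0 : ℝ) < (buffer M K k).card := by
        exact_mod_cast card_buffer_pos (M := M) hK (pos_of_not_isOnline hK hon)
      have h1 := honline k
      simp only [ite_mul, one_mul, zero_mul] at h1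
      rw [← sum_filter] at h1
      rw [abs_div, Nat.abs_cast, div_le_iff₀ hB]
      have h2 : r * (T : ℝ) ≤ (buffer M K k).card :=
        le_trans (by gcongr) (hcov k)
      have h3 : η * (r * T) ≤ η * (buffer M K k).card := by gcongr
      refine h1.trans ?_
      linarith
  have hG : |∑ k ∈ range t, bufferMean M K x k| ≤ 2 * η * t := by
    induction t, ht using Nat.le_induction with
    | base => rwa [sum_bufferMean]
    | succ t ht ih =>
      rw [sum_range_succ]
      push_cast
      have := abs_add_le (∑ k ∈ range t, bufferMean M K x k) (bufferMean M K x t)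
      linarith [hmean t ht]
  have hT : (T : ℝ) ≤ t := by exact_mod_cast ht
  rw [sum_add_distrib]
  have h1 := abs_add_le (∑ k ∈ range t, x k) (∑ k ∈ range t, bufferMean M K x k)
  have h2 := hsum t
  nlinarith

theorem noise_add_bufferMean {S A Ω : Type*} {exper : ℕ → Ω → S → A → ℝ × S}
    {idx : ℕ → Ω → S → A → ℕ} (h : ℝ × S → ℝ) {s : S} {a : A} {k : ℕ} {ω : Ω}
    (hidx : ¬ IsOnline M K k → idx k ω s a ∈ buffer M K k) :
    noise M K exper idx h s a k ω +
      bufferMean M K (fun i => noise M K exper idx h s a i ω) k =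
      h (transition M K exper idx k ω s a) := by
  unfold bufferMean transition
  by_cases hk : IsOnline M K k
  · simp [hk, noise]
  · have h1 : ∑ i ∈ buffer M K k, noise M K exper idx h s a i ω =
        ∑ i ∈ buffer M K k, h (exper i ω s a) :=
      sum_congr rfl fun i hi => by simp [noise, (mem_buffer.1 hi).2]
    simp only [hk, if_false, h1]
    simp [noise, hk, hidx hk]

end Replay

/-! ### The Bellman optimality equation -/

theorem abs_iSup_sub_iSup_le {A : Type*} [Finite A] [Nonempty A] {f g : A → ℝ} {C : ℝ}
    (h : ∀ a, |f a - g a| ≤ C) : |(⨆ a, f a) - ⨆ a, g a| ≤ C := by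
  have hf := Set.finite_range f |>.bddAbove
  have hg := Set.finite_range g |>.bddAbove
  have h1 : ⨆ a, f a ≤ (⨆ a, g a) + C := ciSup_le fun a => by
    linarith [le_ciSup hg a, (abs_le.1 (h a)).2]
  have h2 : ⨆ a, g a ≤ (⨆ a, f a) + C := ciSup_le fun a => by
    linarith [le_ciSup hf a, (abs_le.1 (h a)).1]
  exact abs_le.2 ⟨by linarith, by linarith⟩

theorem abs_iSup_le {A : Type*} [Finite A] [Nonempty A] {f : A → ℝ} {C : ℝ}
    (h : ∀ a, |f a| ≤ C) : |⨆ a, f a| ≤ C := by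
  have := abs_iSup_sub_iSup_le (f := f) (g := fun _ => 0) (C := C) (by simpa using h)
  simpa using this

namespace MDP

variable {S A : Type*} [MeasurableSpace S] (mdp : MDP S A)

theorem transProb_nonneg (s : S) (a : A) (s' : S) : 0 ≤ mdp.transProb s a s' :=
  measureReal_nonneg

theorem abs_meanReward_le {Rmax : ℝ} {s : S} {a : A}
    (hr : ∀ᵐ x ∂(mdp.outcome s a), |x.1| ≤ Rmax) : |mdp.meanReward s a| ≤ Rmax := by
  have := mdp.isProb s a
  have h := norm_integral_le_of_norm_le_const (μ := mdp.outcome s a) (f := fun x => x.1)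
    (C := Rmax) (by simpa using hr)
  simpa [meanReward] using h

variable [Fintype S] [MeasurableSingletonClass S]

theorem integral_comp_snd (s : S) (a : A) (f : S → ℝ) :
    ∫ x, f x.2 ∂(mdp.outcome s a) = ∑ s', mdp.transProb s a s' * f s' := by
  have := mdp.isProb s a
  have hf : Measurable f := measurable_of_finite f
  have : IsProbabilityMeasure ((mdp.outcome s a).map Prod.snd) :=
    Measure.isProbabilityMeasure_map measurable_snd.aemeasurable
  rw [← integral_map (φ := Prod.snd) measurable_snd.aemeasurable hf.aestronglyMeasurable,
    integral_fintype .of_finite]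
  refine Finset.sum_congr rfl fun s' _ => ?_
  rw [map_measureReal_apply measurable_snd (measurableSet_singleton s'), smul_eq_mul]
  rfl

theorem sum_transProb (s : S) (a : A) : ∑ s', mdp.transProb s a s' = 1 := by
  have := mdp.isProb s a
  have h := mdp.integral_comp_snd s a fun _ => 1
  simpa using h.symm

theorem sum_transProb_mul_le {s : S} {a : A} {f : S → ℝ} {C : ℝ} (h : ∀ s', f s' ≤ C) :
    ∑ s', mdp.transProb s a s' * f s' ≤ C :=
  calc ∑ s', mdp.transProb s a s' * f s' ≤ ∑ s', mdp.transProb s a s' * C :=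
        Finset.sum_le_sum fun s' _ => mul_le_mul_of_nonneg_left (h s') (mdp.transProb_nonneg _ _ _)
    _ = C := by rw [← Finset.sum_mul, sum_transProb, one_mul]

theorem abs_sum_transProb_mul_le {s : S} {a : A} {f : S → ℝ} {C : ℝ} (h : ∀ s', |f s'| ≤ C) :
    |∑ s', mdp.transProb s a s' * f s'| ≤ C := by
  refine abs_le'.2 ⟨mdp.sum_transProb_mul_le fun s' => (le_abs_self _).trans (h s'), ?_⟩
  rw [← Finset.sum_neg_distrib]
  simp_rw [← mul_neg]
  exact mdp.sum_transProb_mul_le fun s' => (neg_le_abs _).trans (h s')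

/-- The comparison principle behind policy improvement: a function that is dominated by its
discounted expected next value is nonpositive. -/
theorem nonpos_of_le_discounted {γ : ℝ} (h1 : γ < 1) (h0 : 0 ≤ γ) {π : S → A} {f : S → ℝ}
    (hf : ∀ s, f s ≤ γ * ∑ s', mdp.transProb s (π s) s' * f s') (s : S) : f s ≤ 0 := by
  have : Nonempty S := ⟨s⟩
  obtain ⟨s₀, hs₀⟩ := Finite.exists_max f
  have h2 : f s₀ ≤ γ * f s₀ :=
    (hf s₀).trans (mul_le_mul_of_nonneg_left (mdp.sum_transProb_mul_le hs₀) h0)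
  have h3 : f s₀ ≤ 0 := by nlinarith
  exact (hs₀ s).trans h3

variable {γ Rmax : ℝ}

theorem abs_expReward_le (hr : ∀ s a, ∀ᵐ x ∂(mdp.outcome s a), |x.1| ≤ Rmax) (π : S → A)
    (i : ℕ) (s : S) : |mdp.expReward π i s| ≤ Rmax := by
  induction i generalizing s with
  | zero => exact mdp.abs_meanReward_le (hr s (π s))
  | succ i ih => exact mdp.abs_sum_transProb_mul_le ih

theorem summable_value (h0 : 0 ≤ γ) (h1 : γ < 1)
    (hr : ∀ s a, ∀ᵐ x ∂(mdp.outcome s a), |x.1| ≤ Rmax) (π : S → A) (s : S) :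
    Summable fun i => γ ^ i * mdp.expReward π i s := by
  refine Summable.of_norm_bounded ((summable_geometric_of_lt_one h0 h1).mul_right Rmax)
    fun i => ?_
  rw [norm_mul, norm_pow, Real.norm_of_nonneg h0]
  exact mul_le_mul_of_nonneg_left (mdp.abs_expReward_le hr π i s) (pow_nonneg h0 i)

theorem value_eq_policyQ (h0 : 0 ≤ γ) (h1 : γ < 1)
    (hr : ∀ s a, ∀ᵐ x ∂(mdp.outcome s a), |x.1| ≤ Rmax) (π : S → A) (s : S) :
    mdp.value γ π s = mdp.policyQ γ π s (π s) := by
  have hs := mdp.summable_value h0 h1 hr π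
  have hsum : ∑' i, ∑ s', γ * (mdp.transProb s (π s) s' * (γ ^ i * mdp.expReward π i s')) =
      γ * ∑ s', mdp.transProb s (π s) s' * mdp.value γ π s' := by
    rw [Summable.tsum_finsetSum fun s' _ => ((hs s').mul_left _).mul_left _, Finset.mul_sum]
    exact Finset.sum_congr rfl fun s' _ => by rw [tsum_mul_left, tsum_mul_left, value]
  rw [policyQ, ← hsum, value, (hs s).tsum_eq_zero_add]
  simp only [expReward, pow_zero, one_mul]
  congr 1
  refine tsum_congr fun i => ?_
  rw [Finset.mul_sum]
  exact Finset.sum_congr rfl fun s' _ => by ring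

variable [Fintype A] [Nonempty A]

/-- The Bellman optimality operator on Q-functions. -/
def bellman (γ : ℝ) (q : S → A → ℝ) : S → A → ℝ := fun s a =>
  mdp.meanReward s a + γ * ∑ s', mdp.transProb s a s' * ⨆ a', q s' a'

theorem exists_bellman_fixedPoint (h0 : 0 ≤ γ) (h1 : γ < 1) : ∃ q, mdp.bellman γ q = q := by
  have hc : ContractingWith ⟨γ, h0⟩ (mdp.bellman γ) := by
    refine ⟨by exact_mod_cast h1, LipschitzWith.of_dist_le_mul fun p q => ?_⟩
    have hn : (0 : ℝ) ≤ γ * dist p q := mul_nonneg h0 dist_nonneg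
    refine (dist_pi_le_iff hn).2 fun s => (dist_pi_le_iff hn).2 fun a => ?_
    have e : mdp.bellman γ p s a - mdp.bellman γ q s a =
        γ * ∑ s', mdp.transProb s a s' * ((⨆ a', p s' a') - ⨆ a', q s' a') := by
      simp only [bellman, mul_sub, Finset.sum_sub_distrib]
      ring
    rw [Real.dist_eq, e, abs_mul, abs_of_nonneg h0]
    refine mul_le_mul_of_nonneg_left (mdp.abs_sum_transProb_mul_le fun s' =>
      abs_iSup_sub_iSup_le fun a' => ?_) h0
    rw [← Real.dist_eq]
    exact (dist_le_pi_dist (p s') (q s') a').trans (dist_le_pi_dist p q s')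
  exact ⟨_, hc.fixedPoint_isFixedPt⟩

/-- A fixed point of the Bellman operator is the optimal Q-function: its greedy policy attains it,
and no policy exceeds it. -/
theorem optimalQ_eq_of_bellman_eq (h0 : 0 ≤ γ) (h1 : γ < 1)
    (hr : ∀ s a, ∀ᵐ x ∂(mdp.outcome s a), |x.1| ≤ Rmax) {q : S → A → ℝ}
    (hq : mdp.bellman γ q = q) : mdp.optimalQ γ = q := by
  have hq' : ∀ s a, q s a =
      mdp.meanReward s a + γ * ∑ s', mdp.transProb s a s' * ⨆ a', q s' a' := fun s a =>
    (congrFun (congrFun hq s) a).symm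
  have hbdd : ∀ s, BddAbove (Set.range (q s)) := fun s => (Set.finite_range _).bddAbove
  have hdiff : ∀ (π : S → A) (s : S), mdp.value γ π s - q s (π s) =
      γ * ∑ s', mdp.transProb s (π s) s' * (mdp.value γ π s' - ⨆ a', q s' a') := by
    intro π s
    rw [mdp.value_eq_policyQ h0 h1 hr, policyQ, hq' s (π s)]
    simp only [mul_sub, Finset.sum_sub_distrib]
    ring
  have hle : ∀ (π : S → A) (s : S), mdp.value γ π s ≤ ⨆ a', q s a' := by
    intro π s
    have h := mdp.nonpos_of_le_discounted h1 h0 (π := π)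
      (f := fun s => mdp.value γ π s - ⨆ a', q s a') (fun s => by
        rw [← hdiff]
        linarith [le_ciSup (hbdd s) (π s)]) s
    linarith
  have hpol : ∀ π s a, mdp.policyQ γ π s a ≤ q s a := by
    intro π s a
    rw [policyQ, hq' s a]
    gcongr with s'
    · exact mdp.transProb_nonneg _ _ _
    · exact hle π s'
  choose g hg using fun s => exists_eq_ciSup_of_finite (f := q s)
  have hgreedy : ∀ s, ⨆ a', q s a' ≤ mdp.value γ g s := by
    intro s
    have h := mdp.nonpos_of_le_discounted h1 h0 (π := g)
      (f := fun s => (⨆ a', q s a') - mdp.value γ g s) (fun s => by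
        have := hdiff g s
        rw [hg] at this
        simp only [mul_sub, Finset.sum_sub_distrib] at this ⊢
        linarith) s
    linarith
  funext s a
  have hfin : BddAbove (Set.range fun π => mdp.policyQ γ π s a) :=
    ⟨q s a, by rintro _ ⟨π, rfl⟩; exact hpol π s a⟩
  refine le_antisymm (have : Nonempty (S → A) := ⟨g⟩; ciSup_le fun π => hpol π s a) ?_
  refine le_trans ?_ (le_ciSup hfin g)
  rw [hq' s a, policyQ]
  gcongr with s'
  · exact mdp.transProb_nonneg _ _ _
  · exact hgreedy s'

theorem optimalQ_eq (h0 : 0 ≤ γ) (h1 : γ < 1)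
    (hr : ∀ s a, ∀ᵐ x ∂(mdp.outcome s a), |x.1| ≤ Rmax) (s : S) (a : A) :
    mdp.optimalQ γ s a =
      mdp.meanReward s a + γ * ∑ s', mdp.transProb s a s' * ⨆ a', mdp.optimalQ γ s' a' := by
  obtain ⟨q, hq⟩ := mdp.exists_bellman_fixedPoint h0 h1
  rw [mdp.optimalQ_eq_of_bellman_eq h0 h1 hr hq]
  exact (congrFun (congrFun hq s) a).symm

theorem abs_optimalQ_le (h0 : 0 ≤ γ) (h1 : γ < 1)
    (hr : ∀ s a, ∀ᵐ x ∂(mdp.outcome s a), |x.1| ≤ Rmax) (s : S) (a : A) :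
    |mdp.optimalQ γ s a| ≤ Rmax / (1 - γ) := by
  set q := mdp.optimalQ γ with hq
  have hn : ∀ s a, |q s a| ≤ ‖q‖ := fun s a =>
    (norm_le_pi_norm (q s) a).trans (norm_le_pi_norm q s)
  have hstep : ∀ s a, |q s a| ≤ Rmax + γ * ‖q‖ := by
    intro s a
    rw [hq, mdp.optimalQ_eq h0 h1 hr, ← hq]
    refine (abs_add_le _ _).trans (add_le_add (mdp.abs_meanReward_le (hr s a)) ?_)
    rw [abs_mul, abs_of_nonneg h0]
    exact mul_le_mul_of_nonneg_left (mdp.abs_sum_transProb_mul_le fun s' =>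
      abs_iSup_le fun a' => hn s' a') h0
  have hpos : 0 ≤ Rmax + γ * ‖q‖ := (abs_nonneg _).trans (hstep s a)
  have hnorm : ‖q‖ ≤ Rmax + γ * ‖q‖ :=
    (pi_norm_le_iff_of_nonneg hpos).2 fun s => (pi_norm_le_iff_of_nonneg hpos).2 fun a => hstep s a
  refine (hn s a).trans ?_
  rw [le_div_iff₀ (by linarith)]
  linarith

end MDP

namespace Replay

/-! ### Concentration of the sampled temporal-difference errors -/

open Finset in
/-- Time-uniform concentration of the transitions used by replay: for a bounded function `h` of
transitions of mean `0`, the average of `h` over the first `t` iterations is small for all `t ≥ T`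
simultaneously. -/
theorem IsSampling.measure_exists_abs_sum_transition_gt_le {S A Ω : Type*} [MeasurableSpace S]
    [MeasurableSpace Ω] {mdp : MDP S A} {M K : ℕ} {μ : Measure Ω} [IsProbabilityMeasure μ]
    {exper : ℕ → Ω → S → A → ℝ × S} {idx : ℕ → Ω → S → A → ℕ}
    (hS : IsSampling mdp M K μ exper idx) (hK : 0 < K) {h : ℝ × S → ℝ} (hh : Measurable h)
    {R : ℝ} (hb : ∀ x, |h x| ≤ R) {s : S} {a : A} (h0 : ∫ x, h x ∂(mdp.outcome s a) = 0)
    {r : ℝ} (hr : 0 < r) (hr1 : r ≤ 1) (hcov : ∀ t : ℕ, r * t ≤ ((buffer M K t).card : ℝ))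
    {η L : ℝ} (hη : 0 < η) (hL : 0 < L) {T : ℕ} (hT : 0 < T)
    (hTL : 2 * L * (2 * R) ^ 2 ≤ η ^ 2 * (r * T)) :
    μ {ω | ∃ t, T ≤ t ∧
        4 * η * t < |∑ k ∈ range t, h (transition M K exper idx k ω s a)|} ≤
      6 * ENNReal.ofReal (Real.exp (-L)) := by
  have hT' : (0 : ℝ) < T := by exact_mod_cast hT
  have hLR : 0 ≤ L * (2 * R) ^ 2 := mul_nonneg hL.le (sq_nonneg _)
  have hrT : η ^ 2 * (r * T) ≤ η ^ 2 * T := by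
    gcongr
    exact mul_le_of_le_one_left hT'.le hr1
  set X := noise M K exper idx h s a with hX
  have line := fun (c : ℕ → ℝ) {l : ℝ} (hl : 0 < l) (b : ℝ) =>
    measure_abs_sum_gt_line_le μ hS.history X (2 * R) (hS.measurable_noise hh s a)
      (hS.condSubgaussian_noise hh hb h0 hK) c hl b
  have hl1 : 0 < L / (η * T) := by positivity
  have hl2 : 0 < L / (η * (r * T)) := by positivity
  have h1 := line (fun _ => 1) hl1 (η * T)
  have h2 := line (fun k => if IsOnline M K k then 1 else 0) hl2 (η * (r * T))
  have h3 := line (replayWeight M K T) hl1 (η * T)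
  rw [div_mul_cancel₀ _ (by positivity)] at h1 h2 h3
  have hnull : μ {ω | ¬ ∀ k, ¬ IsOnline M K k → idx k ω s a ∈ buffer M K k} = 0 := by
    rw [← ae_iff, ae_all_iff]
    intro k
    by_cases hk : IsOnline M K k
    · simp [hk]
    · simpa [hk] using hS.ae_idx_mem_buffer hK hk s a
  have hsix : 6 * ENNReal.ofReal (Real.exp (-L)) = 0 + (2 * ENNReal.ofReal (Real.exp (-L)) +
      (2 * ENNReal.ofReal (Real.exp (-L)) + 2 * ENNReal.ofReal (Real.exp (-L)))) := by ring
  rw [hsix]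
  refine le_trans (measure_mono ?_) ((measure_union_le _ _).trans (add_le_add hnull.le
    ((measure_union_le _ _).trans (add_le_add h1
      ((measure_union_le _ _).trans (add_le_add h2 h3))))))
  rintro ω ⟨t, ht, hgt⟩
  by_contra hout
  simp only [Set.mem_union, Set.mem_ofPred_eq, not_or, not_exists, not_lt, not_not] at hout
  obtain ⟨o0, o1, o2, o3⟩ := hout
  refine absurd hgt (not_lt.2 ?_)
  have e : ∀ k, h (transition M K exper idx k ω s a) =
      X k ω + bufferMean M K (fun i => X i ω) k := fun k => (noise_add_bufferMean h (o0 k)).symm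
  simp_rw [e]
  refine abs_sum_add_bufferMean_le hr hη hcov hK (T := T) ?_ ?_ ?_ ht
  · intro t
    have hs1 : L / (η * T) * (2 * R) ^ 2 / 2 ≤ η := by
      rw [div_le_iff₀ two_pos, div_mul_eq_mul_div, div_le_iff₀ (by positivity)]
      nlinarith
    have := o1 t
    simp only [one_pow, sum_const, card_range, nsmul_eq_mul, mul_one, one_mul] at this
    refine this.trans ?_
    gcongr
  · intro t
    have hs2 : L / (η * (r * T)) * (2 * R) ^ 2 / 2 ≤ η := by
      rw [div_le_iff₀ two_pos, div_mul_eq_mul_div, div_le_iff₀ (by positivity)]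
      nlinarith
    have hc : ∑ k ∈ range t, (if IsOnline M K k then (1 : ℝ) else 0) ^ 2 =
        (buffer M K t).card := by
      simp [buffer]
    have := o2 t
    rw [hc] at this
    refine this.trans ?_
    gcongr
  · have hw := sum_replayWeight_sq_le hr hcov hK T
    have hs3 : L / (η * T) * (2 * R) ^ 2 / 2 * (3 * T / r) ≤ η * T := by
      have : L / (η * T) * (2 * R) ^ 2 / 2 * (3 * T / r) =
          3 * (L * (2 * R) ^ 2) / (2 * (η * r)) := by
        field_simp
      rw [this, div_le_iff₀ (by positivity)]
      nlinarith
    have hco : 0 ≤ L / (η * T) * (2 * R) ^ 2 / 2 := by positivity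
    have := o3 T
    have h5 := mul_le_mul_of_nonneg_left hw hco
    linarith

end Replay

namespace MDP

variable {S A : Type*} [MeasurableSpace S] [Fintype S] (mdp : MDP S A)

/-- The temporal-difference error of the optimal Q-function on a transition from `(s, a)`, set to
`0` on the null set of rewards larger than `Rmax` so that it is bounded everywhere. -/
def tdError (γ Rmax : ℝ) (s : S) (a : A) (x : ℝ × S) : ℝ :=
  if |x.1| ≤ Rmax then x.1 + γ * (⨆ a', mdp.optimalQ γ x.2 a') - mdp.optimalQ γ s a else 0

variable {γ Rmax : ℝ}

theorem measurable_tdError [MeasurableSingletonClass S] (s : S) (a : A) :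
    Measurable (mdp.tdError γ Rmax s a) := by
  have h1 : Measurable fun x : ℝ × S => ⨆ a', mdp.optimalQ γ x.2 a' :=
    (measurable_of_finite fun s' => ⨆ a', mdp.optimalQ γ s' a').comp measurable_snd
  have h2 : Measurable fun x : ℝ × S => |x.1| := measurable_fst.abs
  exact Measurable.ite (measurableSet_le h2 measurable_const)
    ((measurable_fst.add (h1.const_mul γ)).sub_const _) measurable_const

variable [MeasurableSingletonClass S] [Fintype A] [Nonempty A]

theorem abs_tdError_le (h0 : 0 ≤ γ) (h1 : γ < 1)
    (hr : ∀ s a, ∀ᵐ x ∂(mdp.outcome s a), |x.1| ≤ Rmax) (s : S) (a : A) (x : ℝ × S) :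
    |mdp.tdError γ Rmax s a x| ≤ 2 * (Rmax / (1 - γ)) := by
  have hq := mdp.abs_optimalQ_le h0 h1 hr
  unfold tdError
  split_ifs with hx
  · have hv : |γ * ⨆ a', mdp.optimalQ γ x.2 a'| ≤ γ * (Rmax / (1 - γ)) := by
      rw [abs_mul, abs_of_nonneg h0]
      exact mul_le_mul_of_nonneg_left (abs_iSup_le fun a' => hq x.2 a') h0
    have e : Rmax + γ * (Rmax / (1 - γ)) = Rmax / (1 - γ) := by
      have : 1 - γ ≠ 0 := by linarith
      field_simp
      ring
    have h2 := abs_sub (x.1 + γ * ⨆ a', mdp.optimalQ γ x.2 a') (mdp.optimalQ γ s a)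
    have h3 := abs_add_le x.1 (γ * ⨆ a', mdp.optimalQ γ x.2 a')
    linarith [hq s a]
  · have := (abs_nonneg _).trans (hq s a)
    simpa using this

theorem integral_tdError (h0 : 0 ≤ γ) (h1 : γ < 1)
    (hr : ∀ s a, ∀ᵐ x ∂(mdp.outcome s a), |x.1| ≤ Rmax) (s : S) (a : A) :
    ∫ x, mdp.tdError γ Rmax s a x ∂(mdp.outcome s a) = 0 := by
  have := mdp.isProb s a
  have hae : mdp.tdError γ Rmax s a =ᵐ[mdp.outcome s a] fun x =>
      x.1 + γ * (⨆ a', mdp.optimalQ γ x.2 a') - mdp.optimalQ γ s a := by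
    filter_upwards [hr s a] with x hx
    simp [tdError, hx]
  have hi1 : Integrable (fun x : ℝ × S => x.1) (mdp.outcome s a) :=
    Integrable.of_bound measurable_fst.aestronglyMeasurable Rmax (by simpa using hr s a)
  have hv : Measurable fun x : ℝ × S => ⨆ a', mdp.optimalQ γ x.2 a' :=
    (measurable_of_finite fun s' => ⨆ a', mdp.optimalQ γ s' a').comp measurable_snd
  have hi2 : Integrable (fun x : ℝ × S => γ * ⨆ a', mdp.optimalQ γ x.2 a')
      (mdp.outcome s a) :=
    (Integrable.of_bound hv.aestronglyMeasurable (Rmax / (1 - γ))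
      (Filter.Eventually.of_forall fun x =>
        abs_iSup_le fun a' => mdp.abs_optimalQ_le h0 h1 hr x.2 a')).const_mul γ
  have hi12 : Integrable (fun x : ℝ × S => x.1 + γ * ⨆ a', mdp.optimalQ γ x.2 a')
      (mdp.outcome s a) := hi1.add hi2
  rw [integral_congr_ae hae, integral_sub hi12 (integrable_const _),
    integral_add hi1 hi2, integral_const_mul,
    mdp.integral_comp_snd s a fun s' => ⨆ a', mdp.optimalQ γ s' a',
    mdp.optimalQ_eq h0 h1 hr s a]
  simp [meanReward]

end MDP

namespace Replay

/-! ### Contraction of the error in stages -/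

/-- `Q` is a run of synchronous Q-learning with learning rates `1 / (t + 1)` on the transitions
`tr`. -/
def IsQLearningRun {S A : Type*} (γ : ℝ) (tr : ℕ → S → A → ℝ × S) (Q : ℕ → S → A → ℝ) : Prop :=
  ∀ t s a, Q (t + 1) s a = (1 - 1 / ((t : ℝ) + 1)) * Q t s a +
    1 / ((t : ℝ) + 1) * ((tr t s a).1 + γ * ⨆ a' : A, Q t (tr t s a).2 a')

theorem abs_apply_le_norm {S A : Type*} [Fintype S] [Fintype A] (q : S → A → ℝ) (s : S) (a : A) :
    |q s a| ≤ ‖q‖ :=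
  (norm_le_pi_norm (q s) a).trans (norm_le_pi_norm q s)

theorem norm_le_of_abs_le {S A : Type*} [Fintype S] [Fintype A] {q : S → A → ℝ} {C : ℝ}
    (hC : 0 ≤ C) (h : ∀ s a, |q s a| ≤ C) : ‖q‖ ≤ C :=
  (pi_norm_le_iff_of_nonneg hC).2 fun s => (pi_norm_le_iff_of_nonneg hC).2 fun a => h s a

namespace IsQLearningRun

variable {S A : Type*} [Fintype S] [Fintype A] [Nonempty A] {γ Rmax : ℝ}
  {tr : ℕ → S → A → ℝ × S} {Q : ℕ → S → A → ℝ}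

theorem abs_apply_le (hQ : IsQLearningRun γ tr Q) (h0 : 0 ≤ γ) (h1 : γ < 1)
    (hr : ∀ t s a, |(tr t s a).1| ≤ Rmax) (t : ℕ) (s : S) (a : A) :
    |Q t s a| ≤ max ‖Q 0‖ (Rmax / (1 - γ)) := by
  induction t generalizing s a with
  | zero => exact (abs_apply_le_norm _ s a).trans (le_max_left _ _)
  | succ t ih =>
    set m := max ‖Q 0‖ (Rmax / (1 - γ)) with hm
    have hRm : Rmax ≤ (1 - γ) * m := by
      have : Rmax / (1 - γ) ≤ m := le_max_right _ _
      rw [div_le_iff₀ (by linarith)] at this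
      linarith
    have hy : |(tr t s a).1 + γ * ⨆ a' : A, Q t (tr t s a).2 a'| ≤ m := by
      refine (abs_add_le _ _).trans ?_
      rw [abs_mul, abs_of_nonneg h0]
      have := mul_le_mul_of_nonneg_left (abs_iSup_le fun a' => ih (tr t s a).2 a') h0
      linarith [hr t s a]
    have ht : (0 : ℝ) < (t : ℝ) + 1 := by positivity
    have hw : (0 : ℝ) ≤ 1 / ((t : ℝ) + 1) := by positivity
    have hw1 : (0 : ℝ) ≤ 1 - 1 / ((t : ℝ) + 1) := by
      rw [sub_nonneg, div_le_one ht]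
      linarith [Nat.cast_nonneg (α := ℝ) t]
    rw [hQ]
    refine (abs_add_le _ _).trans ?_
    rw [abs_mul, abs_mul, abs_of_nonneg hw, abs_of_nonneg hw1]
    have e1 := mul_le_mul_of_nonneg_left (ih s a) hw1
    have e2 := mul_le_mul_of_nonneg_left hy hw
    linarith

variable [MeasurableSpace S] {mdp : MDP S A}

theorem norm_sub_optimalQ_le [MeasurableSingletonClass S] (hQ : IsQLearningRun γ tr Q)
    (h0 : 0 ≤ γ) (h1 : γ < 1) (hR : 0 ≤ Rmax)
    (hmdp : ∀ s a, ∀ᵐ x ∂(mdp.outcome s a), |x.1| ≤ Rmax)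
    (hr : ∀ t s a, |(tr t s a).1| ≤ Rmax) (t : ℕ) :
    ‖Q t - mdp.optimalQ γ‖ ≤ initDist γ Rmax ‖Q 0‖ := by
  have hV : 0 ≤ Rmax / (1 - γ) := div_nonneg hR (by linarith)
  unfold initDist
  refine norm_le_of_abs_le (add_nonneg hV (le_max_of_le_right hV)) fun s a => ?_
  refine (abs_sub _ _).trans ?_
  rw [add_comm]
  exact add_le_add (mdp.abs_optimalQ_le h0 h1 hmdp s a) (hQ.abs_apply_le h0 h1 hr t s a)

/-- With learning rates `1 / (t + 1)` the error at time `t` is the average of the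
temporal-difference errors of the optimal Q-function plus a part contracted by `γ`; the bound is
relative to an earlier time `T`. -/
theorem abs_mul_sub_sub_sum_tdError_le (hQ : IsQLearningRun γ tr Q) (h0 : 0 ≤ γ)
    (hr : ∀ t s a, |(tr t s a).1| ≤ Rmax) {T : ℕ} {D : ℝ}
    (hD : ∀ t, T ≤ t → ‖Q t - mdp.optimalQ γ‖ ≤ D) {t : ℕ} (ht : T ≤ t) (s : S) (a : A) :
    |((t : ℝ) * (Q t s a - mdp.optimalQ γ s a)
        - ∑ k ∈ Finset.range t, mdp.tdError γ Rmax s a (tr k s a))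
      - ((T : ℝ) * (Q T s a - mdp.optimalQ γ s a)
        - ∑ k ∈ Finset.range T, mdp.tdError γ Rmax s a (tr k s a))| ≤ γ * D * (t - T) := by
  induction t, ht using Nat.le_induction with
  | base => simp
  | succ t ht ih =>
    have hstep : ((t + 1 : ℕ) : ℝ) * (Q (t + 1) s a - mdp.optimalQ γ s a) =
        (t : ℝ) * (Q t s a - mdp.optimalQ γ s a) + mdp.tdError γ Rmax s a (tr t s a) +
          γ * ((⨆ a', Q t (tr t s a).2 a') - ⨆ a', mdp.optimalQ γ (tr t s a).2 a') := by
      rw [hQ]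
      simp only [MDP.tdError, hr t s a, if_true]
      have : (t : ℝ) + 1 ≠ 0 := by positivity
      push_cast
      field_simp
      ring
    have hsup : |γ * ((⨆ a', Q t (tr t s a).2 a') - ⨆ a', mdp.optimalQ γ (tr t s a).2 a')| ≤
        γ * D := by
      rw [abs_mul, abs_of_nonneg h0]
      refine mul_le_mul_of_nonneg_left (abs_iSup_sub_iSup_le fun a' => ?_) h0
      exact (abs_apply_le_norm (Q t - mdp.optimalQ γ) _ a').trans (hD t ht)
    rw [hstep, Finset.sum_range_succ]
    have h2 := abs_add_le (((t : ℝ) * (Q t s a - mdp.optimalQ γ s a)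
        - ∑ k ∈ Finset.range t, mdp.tdError γ Rmax s a (tr k s a))
      - ((T : ℝ) * (Q T s a - mdp.optimalQ γ s a)
        - ∑ k ∈ Finset.range T, mdp.tdError γ Rmax s a (tr k s a)))
      (γ * ((⨆ a', Q t (tr t s a).2 a') - ⨆ a', mdp.optimalQ γ (tr t s a).2 a'))
    push_cast
    refine le_trans (le_of_eq ?_) (h2.trans (le_trans (add_le_add ih hsup) (le_of_eq ?_)))
    · congr 1; ring
    · ring

/-- One stage: tripling the time contracts the error bound by `(1 + γ) / 2`. The part of the error
accumulated before `T` has weight at most `1 / 3`, which leaves `γ + (1 - γ) / 3`, and the noise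
uses up the remaining `(1 - γ) / 6`. -/
theorem norm_sub_optimalQ_le_of_three_mul_le (hQ : IsQLearningRun γ tr Q) (h0 : 0 ≤ γ)
    (h1 : γ < 1) (hr : ∀ t s a, |(tr t s a).1| ≤ Rmax) {ε η : ℝ}
    (hη : 32 * η ≤ (1 - γ) * ε) {T : ℕ} (hT : 0 < T)
    (hnoise : ∀ t s a, T ≤ t →
      |∑ k ∈ Finset.range t, mdp.tdError γ Rmax s a (tr k s a)| ≤ 4 * η * t) {D : ℝ}
    (hεD : ε ≤ D) (hD : ∀ t, T ≤ t → ‖Q t - mdp.optimalQ γ‖ ≤ D) {t : ℕ} (ht : 3 * T ≤ t) :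
    ‖Q t - mdp.optimalQ γ‖ ≤ (1 + γ) / 2 * D := by
  have hD0 : 0 ≤ D := (norm_nonneg _).trans (hD T le_rfl)
  have ht' : 3 * (T : ℝ) ≤ t := by exact_mod_cast ht
  have hT' : (0 : ℝ) < T := by exact_mod_cast hT
  refine norm_le_of_abs_le (by positivity) fun s a => ?_
  have hTt : T ≤ t := by omega
  have hmain := hQ.abs_mul_sub_sub_sum_tdError_le h0 hr hD hTt s a
  have hnt := hnoise t s a hTt
  have hnT := hnoise T s a le_rfl
  have heT : |(T : ℝ) * (Q T s a - mdp.optimalQ γ s a)| ≤ T * D := by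
    rw [abs_mul, Nat.abs_cast]
    gcongr
    exact (abs_apply_le_norm (Q T - mdp.optimalQ γ) s a).trans (hD T le_rfl)
  have hη4 : 4 * η * (t + T) ≤ (1 - γ) * D / 6 * t := by
    have e1 : 32 * η ≤ (1 - γ) * D := hη.trans (mul_le_mul_of_nonneg_left hεD (by linarith))
    have e2 : 0 ≤ (1 - γ) * D := mul_nonneg (by linarith) hD0
    nlinarith
  have hT3 : (1 - γ) * D * T ≤ (1 - γ) * D * (t / 3) :=
    mul_le_mul_of_nonneg_left (by linarith) (mul_nonneg (by linarith) hD0)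
  have hfin : |(t : ℝ) * (Q t s a - mdp.optimalQ γ s a)| ≤ t * ((1 + γ) / 2 * D) := by
    rw [abs_le] at hmain hnt hnT heT ⊢
    constructor <;> nlinarith
  rw [abs_mul, Nat.abs_cast] at hfin
  exact le_of_mul_le_mul_left hfin (by linarith)

theorem norm_sub_optimalQ_le_max (hQ : IsQLearningRun γ tr Q) (h0 : 0 ≤ γ)
    (h1 : γ < 1) (hr : ∀ t s a, |(tr t s a).1| ≤ Rmax) {ε η : ℝ} (hε : 0 ≤ ε)
    (hη : 32 * η ≤ (1 - γ) * ε) {T : ℕ} (hT : 0 < T)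
    (hnoise : ∀ t s a, T ≤ t →
      |∑ k ∈ Finset.range t, mdp.tdError γ Rmax s a (tr k s a)| ≤ 4 * η * t) {D : ℝ}
    (hD : ∀ t, ‖Q t - mdp.optimalQ γ‖ ≤ D) (i : ℕ) {t : ℕ} (ht : 3 ^ i * T ≤ t) :
    ‖Q t - mdp.optimalQ γ‖ ≤ max ε (((1 + γ) / 2) ^ i * D) := by
  induction i generalizing t with
  | zero => simpa using Or.inr (hD t)
  | succ i ih =>
    have hTi : T ≤ 3 ^ i * T := Nat.le_mul_of_pos_left T (by positivity)
    have h := hQ.norm_sub_optimalQ_le_of_three_mul_le h0 h1 hr hη (T := 3 ^ i * T)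
      (by positivity) (fun t s a ht => hnoise t s a (hTi.trans ht)) (le_max_left _ _)
      (fun t ht => ih ht) (t := t) (by rw [← mul_assoc, ← pow_succ']; exact ht)
    refine h.trans ?_
    rw [mul_max_of_nonneg _ _ (by linarith), pow_succ', mul_assoc]
    exact max_le_max (mul_le_of_le_one_left hε (by linarith)) le_rfl

end IsQLearningRun

end Replay

namespace Replay

/-! ### Constants and the convergence time -/

theorem isQLearningRun_qValues {S A Ω : Type*} (M K : ℕ) (γ : ℝ) (Q₀ : S → A → ℝ)
    (exper : ℕ → Ω → S → A → ℝ × S) (idx : ℕ → Ω → S → A → ℕ) (ω : Ω) :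
    IsQLearningRun γ (fun t => transition M K exper idx t ω)
      (fun t => qValues M K γ Q₀ exper idx t ω) := fun _ _ _ => rfl

theorem IsSampling.ae_abs_reward_le {S A Ω : Type*} [MeasurableSpace S] [Fintype S] [Fintype A]
    [MeasurableSpace Ω] {mdp : MDP S A} {M K : ℕ} {μ : Measure Ω} [IsProbabilityMeasure μ]
    {exper : ℕ → Ω → S → A → ℝ × S} {idx : ℕ → Ω → S → A → ℕ}
    (hS : IsSampling mdp M K μ exper idx) (hK : 0 < K) {Rmax : ℝ}
    (hr : ∀ s a, ∀ᵐ x ∂(mdp.outcome s a), |x.1| ≤ Rmax) :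
    ∀ᵐ ω ∂μ, ∀ t s a, |(transition M K exper idx t ω s a).1| ≤ Rmax := by
  have h1 : ∀ᵐ ω ∂μ, ∀ k s a, IsOnline M K k → |(exper k ω s a).1| ≤ Rmax := by
    refine ae_all_iff.2 fun k => ae_all_iff.2 fun s => ae_all_iff.2 fun a => ?_
    by_cases hk : IsOnline M K k
    · filter_upwards [hS.ae_exper hk s a (hr s a)] with ω hω _ using hω
    · simp [hk]
  have h2 : ∀ᵐ ω ∂μ, ∀ k s a, ¬ IsOnline M K k → idx k ω s a ∈ buffer M K k := by
    refine ae_all_iff.2 fun k => ae_all_iff.2 fun s => ae_all_iff.2 fun a => ?_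
    by_cases hk : IsOnline M K k
    · simp [hk]
    · filter_upwards [hS.ae_idx_mem_buffer hK hk s a] with ω hω _ using hω
  filter_upwards [h1, h2] with ω hω1 hω2 t s a
  unfold transition
  split_ifs with ht
  · exact hω1 t s a ht
  · exact hω1 _ s a (mem_buffer.1 (hω2 t s a ht)).2

/-- No measurability of `good` is needed: outer measure is subadditive. -/
theorem one_sub_le_measureReal {Ω : Type*} [MeasurableSpace Ω] {μ : Measure Ω}
    [IsProbabilityMeasure μ] {good bad : Set Ω} {δ : ℝ} (hδ : 0 ≤ δ) (h : ∀ ω ∉ bad, ω ∈ good)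
    (hbad : μ bad ≤ ENNReal.ofReal δ) : 1 - δ ≤ μ.real good := by
  have hu : good ∪ bad = Set.univ := Set.eq_univ_of_forall fun ω => by
    by_cases hω : ω ∈ bad
    · exact Or.inr hω
    · exact Or.inl (h ω hω)
  have h1 : μ.real (good ∪ bad) ≤ μ.real good + μ.real bad := measureReal_union_le _ _
  rw [hu, probReal_univ] at h1
  have h2 : μ.real bad ≤ δ := ENNReal.toReal_le_of_le_ofReal hδ hbad
  linarith

/-- `⌈N⌉` stages suffice, as `((1 + γ) / 2) ^ N ≤ exp (-N (1 - γ) / 2) = ε / D`. -/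
theorem pow_ceil_numStages_mul_le {γ ε D : ℝ} (h0 : 0 ≤ γ) (h1 : γ < 1) (hε : 0 < ε)
    (hD : ε ≤ D) : ((1 + γ) / 2) ^ ⌈numStages γ ε D⌉₊ * D ≤ ε := by
  have hDpos : 0 < D := hε.trans_le hD
  have h2 : (1 + γ) / 2 ≤ Real.exp (-((1 - γ) / 2)) := by
    have := Real.add_one_le_exp (-((1 - γ) / 2))
    linarith
  have h3 : ((1 + γ) / 2) ^ ⌈numStages γ ε D⌉₊ ≤ ε / D := by
    calc _ ≤ Real.exp (-((1 - γ) / 2)) ^ ⌈numStages γ ε D⌉₊ :=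
          pow_le_pow_left₀ (by linarith) h2 _
      _ = Real.exp (⌈numStages γ ε D⌉₊ * -((1 - γ) / 2)) := (Real.exp_nat_mul _ _).symm
      _ ≤ Real.exp (Real.log (ε / D)) := by
          refine Real.exp_le_exp.2 ?_
          have h4 := Nat.le_ceil (numStages γ ε D)
          have h5 : numStages γ ε D * ((1 - γ) / 2) = -Real.log (ε / D) := by
            rw [← Real.log_inv, inv_div, numStages]
            have : 1 - γ ≠ 0 := by linarith
            field_simp
          have h6 := mul_le_mul_of_nonneg_right h4 (by linarith : 0 ≤ (1 - γ) / 2)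
          linarith
      _ = ε / D := Real.exp_log (by positivity)
  calc _ ≤ ε / D * D := by gcongr
    _ = ε := div_mul_cancel₀ _ hDpos.ne'

theorem three_pow_ceil_le {N : ℝ} (hN : 0 ≤ N) : (3 : ℝ) ^ ⌈N⌉₊ ≤ 3 * 3 ^ N := by
  rw [← Real.rpow_natCast]
  calc (3 : ℝ) ^ (⌈N⌉₊ : ℝ) ≤ 3 ^ (N + 1) :=
        Real.rpow_le_rpow_of_exponent_le (by norm_num) (Nat.ceil_lt_add_one hN).le
    _ = 3 * 3 ^ N := by rw [Real.rpow_add (by norm_num), Real.rpow_one, mul_comm]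

theorem log_six_mul_div_le {n δ N : ℝ} (hn : 1 ≤ n) (h0 : 0 < δ) (h1 : δ < 1) :
    Real.log (6 * n / δ) ≤ 2 * (Real.log (n / δ) + Real.log (max (Real.exp 1) N)) := by
  have h2 : 1 ≤ Real.log (max (Real.exp 1) N) := by
    rw [Real.le_log_iff_exp_le (lt_max_of_lt_left (Real.exp_pos 1))]
    exact le_max_left _ _
  have h3 : 0 ≤ Real.log (n / δ) := Real.log_nonneg ((one_le_div h0).2 (by linarith))
  have h4 : Real.log 6 ≤ 2 := by
    rw [Real.log_le_iff_le_exp (by norm_num), ← one_add_one_eq_two, Real.exp_add]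
    nlinarith [Real.exp_one_gt_d9]
  rw [mul_div_assoc, Real.log_mul (by norm_num) (by positivity)]
  linarith

/-- The starting time of the stages is large enough for the concentration bound with failure
probability `exp (-L)`, noise level `(1 - γ) ε / 32` and increments of size `2 Rmax / (1 - γ)`. -/
theorem proxy_mul_le {n γ c ε Rmax L W t : ℝ} (hn : 0 < n) (h1 : γ < 1) (hc : 0 < c) (hε : 0 < ε)
    (hLW : L ≤ 2 * W)
    (ht : 65536 * (n * Rmax ^ 2 * W / (c * (1 - γ) ^ 4 * ε ^ 2)) ≤ t) :
    2 * L * (2 * (2 * (Rmax / (1 - γ)))) ^ 2 ≤ ((1 - γ) * ε / 32) ^ 2 * (c / n * t) := by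
  have hg : 0 < 1 - γ := by linarith
  have hco : 0 ≤ ((1 - γ) * ε / 32) ^ 2 * (c / n) := by positivity
  calc 2 * L * (2 * (2 * (Rmax / (1 - γ)))) ^ 2
      ≤ 2 * (2 * W) * (2 * (2 * (Rmax / (1 - γ)))) ^ 2 := by gcongr
    _ = ((1 - γ) * ε / 32) ^ 2 * (c / n) *
          (65536 * (n * Rmax ^ 2 * W / (c * (1 - γ) ^ 4 * ε ^ 2))) := by
        field_simp
        ring
    _ ≤ ((1 - γ) * ε / 32) ^ 2 * (c / n) * t := mul_le_mul_of_nonneg_left ht hco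
    _ = _ := by ring

end Replay

end

theorem theorem1 :
    ∃ C : ℝ, 0 < C ∧
      ∀ (S : Type*) (A : Type*) (Ω : Type*) [Fintype S] [Nonempty S] [Fintype A] [Nonempty A]
        [MeasurableSpace S] [MeasurableSingletonClass S] [MeasurableSpace Ω]
        (μ : Measure Ω) [IsProbabilityMeasure μ]
        (mdp : MDP S A) (M K : ℕ) (γ δ ε₁ Rmax c : ℝ) (Q₀ : S → A → ℝ)
        (exper : ℕ → Ω → S → A → ℝ × S) (idx : ℕ → Ω → S → A → ℕ),
        0 < K → 0 < γ → γ < 1 → 0 < δ → δ < 1 → 0 < ε₁ →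
        (∀ s a, ∀ᵐ x ∂(mdp.outcome s a), |x.1| ≤ Rmax) →
        Replay.IsCoveringConstant (Fintype.card S * Fintype.card A) M K c →
        Replay.IsSampling mdp M K μ exper idx →
        1 - δ ≤ μ.real {ω | ∀ t : ℕ,
          C * Replay.convTime (Fintype.card S * Fintype.card A) γ c ε₁ δ Rmax
              (Replay.initDist γ Rmax ‖Q₀‖) ≤ (t : ℝ) →
            ‖Replay.qValues M K γ Q₀ exper idx t ω - mdp.optimalQ γ‖ ≤ ε₁} := by
  refine ⟨3 * 65537, by norm_num, ?_⟩
  intro S A Ω _ _ _ _ _ _ _ μ _ mdp M K γ δ ε Rmax c Q₀ exper idx hK hγ0 hγ1 hδ0 hδ1 hε hr hc hS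
  obtain ⟨hc0, hc1, hcov⟩ := hc
  obtain ⟨s₀⟩ := ‹Nonempty S›
  obtain ⟨a₀⟩ := ‹Nonempty A›
  have hR : 0 ≤ Rmax := (abs_nonneg _).trans (mdp.abs_meanReward_le (hr s₀ a₀))
  have hrun := Replay.isQLearningRun_qValues M K γ Q₀ exper idx
  set D := Replay.initDist γ Rmax ‖Q₀‖ with hDdef
  have hbounded : ∀ ω, (∀ t s a, |(Replay.transition M K exper idx t ω s a).1| ≤ Rmax) →
      ∀ t, ‖Replay.qValues M K γ Q₀ exper idx t ω - mdp.optimalQ γ‖ ≤ D := fun ω hω t =>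
    (hrun ω).norm_sub_optimalQ_le hγ0.le hγ1 hR hr hω t
  have hnull : μ {ω | ¬ ∀ t s a, |(Replay.transition M K exper idx t ω s a).1| ≤ Rmax} = 0 :=
    ae_iff.1 (hS.ae_abs_reward_le hK hr)
  -- If `D ≤ ε` the number of stages is not positive and the convergence time may be tiny, but the
  -- claim holds at all times. This includes the junk value `log 0` at `D = 0`.
  rcases le_or_gt D ε with hDε | hDε
  · refine Replay.one_sub_le_measureReal hδ0.le (fun ω hω t _ => ?_)
      (hnull.le.trans zero_le)
    exact (hbounded ω (not_not.1 hω) t).trans hDε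
  set n : ℕ := Fintype.card S * Fintype.card A with hn
  have hnpos : 0 < n := Nat.mul_pos (Fintype.card_pos_iff.2 ⟨s₀⟩) (Fintype.card_pos_iff.2 ⟨a₀⟩)
  have hn1 : (1 : ℝ) ≤ n := by exact_mod_cast hnpos
  have hn0 : (0 : ℝ) < n := by linarith
  set N := Replay.numStages γ ε D with hN
  have hN0 : 0 ≤ N := mul_nonneg (div_nonneg zero_le_two (by linarith))
    (Real.log_nonneg ((one_le_div hε).2 hDε.le))
  set W := Real.log (n / δ) + Real.log (max (Real.exp 1) N) with hW
  set m := max 1 (n * Rmax ^ 2 * W / (c * (1 - γ) ^ 4 * ε ^ 2)) with hm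
  have hm1 : 1 ≤ m := le_max_left _ _
  set T := ⌈65536 * m⌉₊ with hT
  -- Rounding `T` up costs `1 ≤ m`; the factor `3` of the theorem pays for rounding up `N`.
  have hTlow : 65536 * m ≤ T := Nat.le_ceil _
  have hTup : (T : ℝ) ≤ 65537 * m := by
    have := (Nat.ceil_lt_add_one (by positivity : 0 ≤ 65536 * m)).le
    linarith
  have hTpos : 0 < T := Nat.ceil_pos.2 (by positivity)
  -- There are `n` pairs, each failing with probability at most `6 exp (-L)`.
  set L := Real.log (6 * n / δ) with hL
  have hL0 : 0 < L := Real.log_pos ((one_lt_div hδ0).2 (by linarith))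
  have hproxy : 2 * L * (2 * (2 * (Rmax / (1 - γ)))) ^ 2 ≤
      ((1 - γ) * ε / 32) ^ 2 * (c / n * T) :=
    Replay.proxy_mul_le hn0 hγ1 hc0 hε (Replay.log_six_mul_div_le hn1 hδ0 hδ1)
      ((mul_le_mul_of_nonneg_left (le_max_right _ _) (by norm_num)).trans hTlow)
  have hη : 0 < (1 - γ) * ε / 32 := div_pos (mul_pos (by linarith) hε) (by norm_num)
  have hconc := fun s a => hS.measure_exists_abs_sum_transition_gt_le hK
    (mdp.measurable_tdError s a) (mdp.abs_tdError_le hγ0.le hγ1 hr s a)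
    (mdp.integral_tdError hγ0.le hγ1 hr s a) (r := c / n) (by positivity)
    ((div_le_one hn0).2 (by linarith))
    (fun t => by rw [div_mul_eq_mul_div]; exact hcov t) hη hL0 hTpos hproxy
  set bad : S → A → Set Ω := fun s a => {ω | ∃ t, T ≤ t ∧ 4 * ((1 - γ) * ε / 32) * t <
    |∑ k ∈ Finset.range t,
      mdp.tdError γ Rmax s a (Replay.transition M K exper idx k ω s a)|} with hbad
  refine Replay.one_sub_le_measureReal (bad :=
    {ω | ¬ ∀ t s a, |(Replay.transition M K exper idx t ω s a).1| ≤ Rmax} ∪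
      ⋃ s, ⋃ a, bad s a) hδ0.le (fun ω hω t ht => ?_) ?_
  · simp only [Set.mem_union, Set.mem_ofPred_eq, not_or, not_not, Set.mem_iUnion, not_exists,
      hbad, not_and, not_lt] at hω
    obtain ⟨hω1, hω2⟩ := hω
    have hstages := (hrun ω).norm_sub_optimalQ_le_max hγ0.le hγ1 hω1 hε.le
      (η := (1 - γ) * ε / 32) (by linarith) hTpos (fun t s a ht => hω2 s a t ht)
      (hbounded ω hω1) ⌈N⌉₊ (t := t) (by
        have h3 := Replay.three_pow_ceil_le hN0
        have h4 : (3 : ℝ) ^ ⌈N⌉₊ * T ≤ 3 * 3 ^ N * (65537 * m) :=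
          mul_le_mul h3 hTup (by positivity) (by positivity)
        have h5 : (3 : ℝ) ^ ⌈N⌉₊ * T ≤ t := by
          refine h4.trans (le_trans (le_of_eq ?_) ht)
          rw [Replay.convTime]
          ring
        exact_mod_cast h5)
    exact hstages.trans (max_le le_rfl (Replay.pow_ceil_numStages_mul_le hγ0.le hγ1 hε hDε.le))
  · calc _ ≤ 0 + ∑ _s : S, ∑ _a : A, 6 * ENNReal.ofReal (Real.exp (-L)) := by
          refine (measure_union_le _ _).trans (add_le_add hnull.le ?_)
          refine (measure_iUnion_fintype_le _ _).trans (Finset.sum_le_sum fun s _ => ?_)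
          exact (measure_iUnion_fintype_le _ _).trans (Finset.sum_le_sum fun a _ => hconc s a)
      _ = ENNReal.ofReal (n * (6 * Real.exp (-L))) := by
          rw [ENNReal.ofReal_mul (by positivity), ENNReal.ofReal_mul (by norm_num)]
          simp [hn, mul_assoc]
      _ = ENNReal.ofReal δ := by
          congr 1
          rw [Real.exp_neg, hL, Real.exp_log (by positivity)]
          field_simp
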